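/- **($L_2$-invariance principle)** Let $Q$ be one of the following compact connected two-point homogeneous spaces: a sphere $S^d$ ($d\ge 1$), a projective space $\mathbb{R}P^n$, $\mathbb{C}P^n$, $\mathbb{H}P^n$ ($n\ge 2$), or the octonionic projective plane $\mathbb{O}P^2$. Let $\theta$ be the invariant Riemannian distance on $Q$, normalized so that $Q$ has $\theta$-diameter $\pi$, and let $\mu$ be the invariant Riemannian measure, normalized so that $\mu(Q)=1$. Write $B_r(y)=\{x\in Q:\theta(x,y)<r\}$, let $\tau(x,y)=\sin\frac12\theta(x,y)$ be the chordal metric, and let $\eta^\natural(r)=\sin r$ for $0\le r\le\pi$. For a set $\mathcal D_N\subset Q$ of $N$ points (not necessarily different, counted with multiplicity) put $$\lambda[\eta^\natural,\mathcal D_N]=\int_0^\pi\int_Q\bigl(\#\{B_r(y)\cap\mathcal D_N\}-N\mu(B_r(y))\bigr)^2\,d\mu(y)\,\sin r\,dr,\qquad \tau[\mathcal D_N]=\sum_{x_1,x_2\in\mathcal D_N}\tau(x_1,x_2),$$ and let $\lambda_N(\eta^\natural)=\inf_{\mathcal D_N}\lambda[\eta^\natural,\mathcal D_N]$ and $\tau_N=\sup_{\mathcal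 D_N}\tau[\mathcal D_N]$ over all such $N$-point sets. Let $$\theta^\Delta(\eta^\natural,x,y)=\int_0^\pi\tfrac12\,\mu\bigl(B_r(x)\,\triangle\,B_r(y)\bigr)\sin r\,dr .$$ For a metric $\rho$ on $Q$ write $\langle\rho\rangle=\iint_{Q\times Q}\rho(x,y)\,d\mu(x)\,d\mu(y)$ and $\operatorname{diam}(Q,\rho)=\sup_{x,y\in Q}\rho(x,y)$. Then, with the constant $$\gamma(Q)=\frac{\langle\tau\rangle}{\langle\theta^\Delta(\eta^\natural)\rangle}=\frac{\operatorname{diam}(Q,\tau)}{\operatorname{diam}(Q,\theta^\Delta(\eta^\natural))},$$ (the equality of the two quotients being part of the claim), for every $N$ and every $N$-point set $\mathcal D_N\subset Q$, $$\gamma(Q)\,\lambda[\eta^\natural,\mathcal D_N]+\tau[\mathcal D_N]=\langle\tau\rangle N^2,$$ and, for every $N$, $$\gamma(Q)\,\lambda_N(\eta^\natural)+\tau_N=\langle\tau\rangle N^2 .$$ -/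

import Mathlib

open MeasureTheory Set
open scoped Quaternion

noncomputable section

/-! ### The octonions -/

/-- The octonions `𝕆`, obtained from the quaternions by the Cayley-Dickson construction: pairs of
quaternions with the Euclidean norm `|(a, b)|² = |a|² + |b|²`. -/
def Octonion : Type := WithLp 2 (ℍ[ℝ] × ℍ[ℝ])

namespace Octonion

instance : NormedAddCommGroup Octonion :=
  inferInstanceAs (NormedAddCommGroup (WithLp 2 (ℍ[ℝ] × ℍ[ℝ])))

instance : InnerProductSpace ℝ Octonion :=
  inferInstanceAs (InnerProductSpace ℝ (WithLp 2 (ℍ[ℝ] × ℍ[ℝ])))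

/-- The octonion with quaternionic components `a`, `b`. -/
def mk (a b : ℍ[ℝ]) : Octonion := WithLp.toLp 2 (a, b)

/-- First quaternionic component. -/
def left (x : Octonion) : ℍ[ℝ] := (WithLp.ofLp x).1

/-- Second quaternionic component. -/
def right (x : Octonion) : ℍ[ℝ] := (WithLp.ofLp x).2

instance : One Octonion := ⟨mk 1 0⟩

/-- The Cayley-Dickson product `(a, b) (c, d) = (a c - d̄ b, d a + b c̄)`. -/
instance : Mul Octonion :=
  ⟨fun x y => mk (x.left * y.left - star y.right * x.right)
    (y.right * x.left + x.right * star y.left)⟩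

/-- Octonionic conjugation `(a, b) ↦ (ā, -b)`. -/
instance : Star Octonion := ⟨fun x => mk (star x.left) (-x.right)⟩

end Octonion

/-! ### Models of the compact connected two-point homogeneous spaces -/

/-- The space of `(n+1) × (n+1)` matrices with entries in `F`, with the inner product
`⟨A, B⟩ = ∑ i j, Re (a_ij * conj b_ij)`. -/
abbrev MatrixSpace (F : Type) [NormedAddCommGroup F] [InnerProductSpace ℝ F] (n : ℕ) : Type :=
  PiLp 2 (fun _ : Fin (n + 1) × Fin (n + 1) => F)

/-- The projective space `F Pⁿ` as the set of Hermitian idempotent `(n+1) × (n+1)` matrices of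
trace `1` over `F`: `Π* = Π`, `Π² = Π`, `Tr Π = 1`. For associative `F` these are the orthogonal
projectors onto the lines of `F ^ (n+1)`. -/
def projectiveSpace (F : Type) [NormedAddCommGroup F] [InnerProductSpace ℝ F]
    [Mul F] [One F] [Star F] (n : ℕ) : Set (MatrixSpace F n) :=
  {A | (Matrix.of fun i j => A (i, j)).IsHermitian ∧
    (Matrix.of fun i j => A (i, j)) * (Matrix.of fun i j => A (i, j)) =
      (Matrix.of fun i j => A (i, j)) ∧
    (Matrix.of fun i j => A (i, j)).trace = 1}

/-- The list of the spaces `Q = Q(d, d₀)`: spheres `S^d` with `d ≥ 1`, the projective spaces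
`ℝPⁿ`, `ℂPⁿ`, `ℍPⁿ` with `n ≥ 2`, and the octonionic projective plane `𝕆P²`. -/
inductive TwoPointSpace : Type
  | sphere (d : ℕ) (hd : 1 ≤ d)
  | realProjective (n : ℕ) (hn : 2 ≤ n)
  | complexProjective (n : ℕ) (hn : 2 ≤ n)
  | quaternionicProjective (n : ℕ) (hn : 2 ≤ n)
  | octonionicPlane

namespace TwoPointSpace

/-- The real dimension `d` of `Q(d, d₀)`: `d = n d₀` with `d₀ = 1, 2, 4, 8` for the projective
spaces over `ℝ, ℂ, ℍ, 𝕆`. -/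
def dim : TwoPointSpace → ℕ
  | sphere d _ => d
  | realProjective n _ => n
  | complexProjective n _ => 2 * n
  | quaternionicProjective n _ => 4 * n
  | octonionicPlane => 16

/-- The Euclidean space in which the model of `Q` is embedded. -/
def Ambient : TwoPointSpace → Type
  | sphere d _ => EuclideanSpace ℝ (Fin (d + 1))
  | realProjective n _ => MatrixSpace ℝ n
  | complexProjective n _ => MatrixSpace ℂ n
  | quaternionicProjective n _ => MatrixSpace ℍ[ℝ] n
  | octonionicPlane => MatrixSpace Octonion 2

instance instNormedAddCommGroupAmbient : (Q : TwoPointSpace) → NormedAddCommGroup Q.Ambient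
  | sphere d _ => inferInstanceAs (NormedAddCommGroup (EuclideanSpace ℝ (Fin (d + 1))))
  | realProjective n _ => inferInstanceAs (NormedAddCommGroup (MatrixSpace ℝ n))
  | complexProjective n _ => inferInstanceAs (NormedAddCommGroup (MatrixSpace ℂ n))
  | quaternionicProjective n _ => inferInstanceAs (NormedAddCommGroup (MatrixSpace ℍ[ℝ] n))
  | octonionicPlane => inferInstanceAs (NormedAddCommGroup (MatrixSpace Octonion 2))

instance instInnerProductSpaceAmbient : (Q : TwoPointSpace) → InnerProductSpace ℝ Q.Ambient
  | sphere d _ => inferInstanceAs (InnerProductSpace ℝ (EuclideanSpace ℝ (Fin (d + 1))))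
  | realProjective n _ => inferInstanceAs (InnerProductSpace ℝ (MatrixSpace ℝ n))
  | complexProjective n _ => inferInstanceAs (InnerProductSpace ℝ (MatrixSpace ℂ n))
  | quaternionicProjective n _ => inferInstanceAs (InnerProductSpace ℝ (MatrixSpace ℍ[ℝ] n))
  | octonionicPlane => inferInstanceAs (InnerProductSpace ℝ (MatrixSpace Octonion 2))

instance instMeasurableSpaceAmbient (Q : TwoPointSpace) : MeasurableSpace Q.Ambient :=
  borel Q.Ambient

instance instBorelSpaceAmbient (Q : TwoPointSpace) : BorelSpace Q.Ambient := ⟨rfl⟩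

/-- The set of points of the model of `Q` in its ambient Euclidean space. -/
def points : (Q : TwoPointSpace) → Set Q.Ambient
  | sphere d _ => Metric.sphere (0 : EuclideanSpace ℝ (Fin (d + 1))) 1
  | realProjective n _ => projectiveSpace ℝ n
  | complexProjective n _ => projectiveSpace ℂ n
  | quaternionicProjective n _ => projectiveSpace ℍ[ℝ] n
  | octonionicPlane => projectiveSpace Octonion 2

/-- The space `Q` as a type. Its Mathlib metric is the restricted Euclidean distance; its Borel
sets are those of the compact manifold `Q`. -/
abbrev Carrier (Q : TwoPointSpace) : Type := Q.points

/-- The invariant Riemannian (geodesic) distance `θ` on `Q`, normalized to have diameter `π`: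
`cos θ(x, y) = ⟨x, y⟩` on spheres, and on projective spaces `cos² (θ(x, y) / 2) = ⟨x, y⟩`, that is
`cos (θ / 2) = |(a, b)|` for the projectors onto the lines spanned by the unit vectors `a`, `b`. -/
def theta : (Q : TwoPointSpace) → Q.Carrier → Q.Carrier → ℝ
  | sphere d hd => fun x y => Real.arccos (inner ℝ (x : (sphere d hd).Ambient) y)
  | realProjective n hn => fun x y =>
      2 * Real.arccos (Real.sqrt (inner ℝ (x : (realProjective n hn).Ambient) y))
  | complexProjective n hn => fun x y =>
      2 * Real.arccos (Real.sqrt (inner ℝ (x : (complexProjective n hn).Ambient) y))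
  | quaternionicProjective n hn => fun x y =>
      2 * Real.arccos (Real.sqrt (inner ℝ (x : (quaternionicProjective n hn).Ambient) y))
  | octonionicPlane => fun x y =>
      2 * Real.arccos (Real.sqrt (inner ℝ (x : octonionicPlane.Ambient) y))

/-- The Riemannian measure of the compact `d`-dimensional submanifold `Q` of its ambient Euclidean
space, that is the `d`-dimensional Hausdorff measure, normalized to total mass `1`. It is invariant
under all isometries of `Q`, hence it is the normalized invariant measure. -/
def mu (Q : TwoPointSpace) : Measure Q.Carrier :=
  (μH[(Q.dim : ℝ)] (univ : Set Q.Carrier))⁻¹ • μH[(Q.dim : ℝ)]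

/-- The chordal metric `τ(x, y) = sin (θ(x, y) / 2)`. -/
def tau (Q : TwoPointSpace) (x y : Q.Carrier) : ℝ := Real.sin (Q.theta x y / 2)

end TwoPointSpace

/-! ### Discrepancies and sums of distances on a space with distance `θ` and measure `μ` -/

section Discrepancy

variable {M : Type}

/-- The ball `B_r(y) = {x : θ(x, y) < r}`. -/
def thetaBall (θ : M → M → ℝ) (r : ℝ) (y : M) : Set M := {x | θ x y < r}

open Classical in
/-- The local discrepancy `#{B_r(y) ∩ D_N} - N μ(B_r(y))`. An `N`-point set with points that are not
necessarily different is a family `D : Fin N → M`; points are counted with multiplicity. -/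
def localDiscrepancy [MeasurableSpace M] (θ : M → M → ℝ) (μ : Measure M) {N : ℕ} (D : Fin N → M)
    (r : ℝ) (y : M) : ℝ :=
  ((Finset.univ.filter fun i => D i ∈ thetaBall θ r y).card : ℝ) - N * μ.real (thetaBall θ r y)

/-- The quadratic discrepancy `λ_r[D_N]` for balls of radius `r`. -/
def quadraticDiscrepancyAt [MeasurableSpace M] (θ : M → M → ℝ) (μ : Measure M) {N : ℕ}
    (D : Fin N → M) (r : ℝ) : ℝ :=
  ∫ y, (localDiscrepancy θ μ D r y) ^ 2 ∂μ

/-- The weighted quadratic discrepancy `λ[η, D_N] = ∫₀^π λ_r[D_N] η(r) dr`. -/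
def quadraticDiscrepancy [MeasurableSpace M] (θ : M → M → ℝ) (μ : Measure M) (η : ℝ → ℝ) {N : ℕ}
    (D : Fin N → M) : ℝ :=
  ∫ r in (0 : ℝ)..Real.pi, quadraticDiscrepancyAt θ μ D r * η r

/-- The extremal discrepancy `λ_N(η)`, the infimum over all `N`-point sets. -/
def extremalDiscrepancy [MeasurableSpace M] (θ : M → M → ℝ) (μ : Measure M) (η : ℝ → ℝ)
    (N : ℕ) : ℝ :=
  ⨅ D : Fin N → M, quadraticDiscrepancy θ μ η D

/-- The symmetric difference metric
`θ^Δ(η, x, y) = ∫₀^π (1/2) μ(B_r(x) ∆ B_r(y)) η(r) dr`. -/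
def symmDiffMetric [MeasurableSpace M] (θ : M → M → ℝ) (μ : Measure M) (η : ℝ → ℝ)
    (x y : M) : ℝ :=
  ∫ r in (0 : ℝ)..Real.pi,
    (1 / 2 * μ.real (symmDiff (thetaBall θ r x) (thetaBall θ r y))) * η r

/-- The sum of pairwise distances `ρ[D_N]`, over all ordered pairs. -/
def distanceSum (ρ : M → M → ℝ) {N : ℕ} (D : Fin N → M) : ℝ :=
  ∑ i, ∑ j, ρ (D i) (D j)

/-- The extremal sum of distances `ρ_N`, the supremum over all `N`-point sets. -/
def extremalDistanceSum (ρ : M → M → ℝ) (N : ℕ) : ℝ :=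
  ⨆ D : Fin N → M, distanceSum ρ D

/-- The average value `⟨ρ⟩ = ∬ ρ(x, y) dμ(x) dμ(y)`. -/
def averageDistance [MeasurableSpace M] (μ : Measure M) (ρ : M → M → ℝ) : ℝ :=
  ∫ x, ∫ y, ρ x y ∂μ ∂μ

/-- The diameter of the space with respect to `ρ`. -/
def diameter (ρ : M → M → ℝ) : ℝ :=
  ⨆ p : M × M, ρ p.1 p.2

end Discrepancy

/-- The constant `γ(Q) = ⟨τ⟩ / ⟨θ^Δ(η♮)⟩` with `η♮(r) = sin r`. -/
def TwoPointSpace.gamma (Q : TwoPointSpace) : ℝ :=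
  averageDistance Q.mu Q.tau / averageDistance Q.mu (symmDiffMetric Q.theta Q.mu Real.sin)

end

/-! On a space where every ball of radius r has the same measure v(r), expanding the square of the
local discrepancy turns the integral into a sum over pairs of points. The pair (x, y) contributes
μ(B_r(x) ∩ B_r(y)) - v², which equals (v - v²) - ½ μ(B_r(x) ∆ B_r(y)). Integrating against η gives
λ[η, D] = N²⟨θ^Δ(η)⟩ - θ^Δ(η)[D] (`quadraticDiscrepancy_sin_eq`). The theorem is therefore
equivalent in substance to the proportionality of θ^Δ(η♮) and τ. If θ^Δ = cτ, then both quotients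
defining γ equal 1/c, and the extremal identity holds because λ is a decreasing affine function of
τ[D] (`stolarsky_of_proportional`).

Proportionality comes from the weight sin r. The radii r for which z lies in exactly one of B_r(x),
B_r(y) fill the interval between θ(x, z) and θ(y, z), so Fubini gives θ^Δ(x, y) = ½ ∫ |cos θ(x, z) -
cos θ(y, z)| dμ(z) (`symmDiffMetric_sin_eq`). Each Q sits in a Euclidean unit sphere with cos θ =
κ⟨x, y⟩ + b and κ + b = 1. The integrand is then κ|⟨x - y, z⟩|, while τ(x, y) = (√κ/2)‖x - y‖. It
remains that ∫ |⟨x - y, z⟩| dμ(z) depends only on the length of the chord x - y. This holds because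
linear symmetries of Q carry every chord to a multiple of one fixed vector
(`stolarsky_of_embedded`).

On spheres a reflection does this. On projective spaces `exists_symmetry_pair` moves a pair of
projectors to real ones. A difference of two real rank-one projectors has eigenvalues s, -s, 0, …,
0, so a real orthogonal conjugation makes it s(E₀ - E₁), where E₀, E₁ project onto the first two
coordinate axes (`exists_diagonalizing_basis`). All that depends on the algebra is gathered in
`IsProjectiveGeometry`. It is proved with diagonal unitary matrices in the associative cases, and
with triality maps built from the Moufang identities and real rotations for 𝕆P². Positivity and
finiteness of the Hausdorff measure follow from homogeneity and one explicit chart. -/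

noncomputable section

/-! ### The invariance principle on an abstract space whose balls of equal radius have equal
measure. -/

section Stolarsky

variable {M : Type}

/-- The indicator of `θ x y < r`, as a function of the radius and the two points. -/
def ballIndicator (θ : M → M → ℝ) (r : ℝ) (x y : M) : ℝ :=
  open Classical in if θ x y < r then 1 else 0

lemma ballIndicator_nonneg (θ : M → M → ℝ) (r : ℝ) (x y : M) : 0 ≤ ballIndicator θ r x y := by
  unfold ballIndicator; split_ifs <;> norm_num

lemma ballIndicator_le_one (θ : M → M → ℝ) (r : ℝ) (x y : M) : ballIndicator θ r x y ≤ 1 := by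
  unfold ballIndicator; split_ifs <;> norm_num

lemma norm_ballIndicator_le (θ : M → M → ℝ) (r : ℝ) (x y : M) : ‖ballIndicator θ r x y‖ ≤ 1 := by
  rw [Real.norm_of_nonneg (ballIndicator_nonneg ..)]; exact ballIndicator_le_one ..

lemma ballIndicator_eq_indicator {θ : M → M → ℝ} (hs : ∀ x y, θ x y = θ y x) (r : ℝ) (x y : M) :
    ballIndicator θ r x y = (thetaBall θ r x).indicator (fun _ => 1) y := by
  simp only [ballIndicator, thetaBall, indicator, hs x y, mem_ofPred_eq]
  by_cases h : θ y x < r <;> simp only [h, if_true, if_false]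

/-- `∫ |1[a < r] - 1[b < r]| sin r dr` over `[0, π]`. -/
lemma integral_abs_sub_step_mul_sin {a b : ℝ} (ha : a ∈ Icc 0 Real.pi) (hb : b ∈ Icc 0 Real.pi) :
    ∫ r in (0 : ℝ)..Real.pi,
      |(if a < r then (1 : ℝ) else 0) - (if b < r then 1 else 0)| * Real.sin r =
      |Real.cos a - Real.cos b| := by
  wlog hab : a ≤ b generalizing a b
  · rw [abs_sub_comm, ← this hb ha (le_of_not_ge hab)]
    simp only [abs_sub_comm]
  -- The two steps differ exactly on (a, b], so the integral is that of sin over this interval.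
  have h1 : ∀ r : ℝ, |(if a < r then (1 : ℝ) else 0) - (if b < r then 1 else 0)| * Real.sin r =
      (Ioc a b).indicator Real.sin r := by
    intro r
    by_cases h1 : a < r <;> by_cases h2 : b < r
    · simp [h1, h2, indicator]
    · simp [h1, h2, indicator, not_lt.1 h2]
    · exact absurd (hab.trans_lt h2) h1
    · simp [h1, h2, indicator]
  simp only [h1]
  rw [intervalIntegral.integral_of_le Real.pi_pos.le, setIntegral_indicator measurableSet_Ioc,
    inter_eq_self_of_subset_right (Ioc_subset_Ioc ha.1 hb.2),
    ← intervalIntegral.integral_of_le hab, integral_sin, abs_of_nonneg]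
  exact sub_nonneg.2 (Real.cos_le_cos_of_nonneg_of_le_pi ha.1 hb.2 hab)

lemma monotone_measureReal_thetaBall [MeasurableSpace M] {μ : Measure M}
    [IsProbabilityMeasure μ] (θ : M → M → ℝ) (x : M) : Monotone fun r => μ.real (thetaBall θ r x) :=
  fun _ _ h => measureReal_mono fun _ hz => lt_of_lt_of_le hz h

/-- As all balls of radius r have measure v, the term Nv can be shared out as v per point; the
square of the discrepancy then becomes a double sum over pairs. -/
lemma localDiscrepancy_eq [MeasurableSpace M] {μ : Measure M} {θ : M → M → ℝ} {N : ℕ} (D : Fin N → M) {r : ℝ} {v : ℝ}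
    (hv : ∀ x, μ.real (thetaBall θ r x) = v) (y : M) :
    localDiscrepancy θ μ D r y = ∑ i, (ballIndicator θ r (D i) y - v) := by
  unfold localDiscrepancy
  rw [hv, Finset.sum_sub_distrib]
  simp only [ballIndicator, thetaBall, Finset.sum_boole, mem_ofPred_eq]
  simp
  congr

variable [TopologicalSpace M] [SecondCountableTopology M]
  [MeasurableSpace M] [BorelSpace M] {μ : Measure M} {θ : M → M → ℝ}

/-- Joint measurability in the radius and both points is what every later use of Fubini needs. -/
lemma measurable_ballIndicator (hθ : Continuous fun p : M × M => θ p.1 p.2) :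
    Measurable fun p : ℝ × M × M => ballIndicator θ p.1 p.2.1 p.2.2 := by
  refine Measurable.ite ?_ measurable_const measurable_const
  exact measurableSet_lt (hθ.measurable.comp measurable_snd) measurable_fst

lemma measurableSet_thetaBall (hθ : Continuous fun p : M × M => θ p.1 p.2) (r : ℝ) (y : M) :
    MeasurableSet (thetaBall θ r y) :=
  measurableSet_lt (hθ.measurable.comp (measurable_id.prodMk measurable_const)) measurable_const

lemma integral_ballIndicator (hθ : Continuous fun p : M × M => θ p.1 p.2)
    (hs : ∀ x y, θ x y = θ y x) (r : ℝ) (x : M) :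
    ∫ z, ballIndicator θ r x z ∂μ = μ.real (thetaBall θ r x) := by
  simp_rw [ballIndicator_eq_indicator hs]
  rw [integral_indicator (measurableSet_thetaBall hθ r x)]
  simp

lemma measurable_ballIndicator_right (hθ : Continuous fun p : M × M => θ p.1 p.2) (r : ℝ) (x : M) :
    Measurable (ballIndicator θ r x) :=
  (measurable_ballIndicator hθ).comp
    (measurable_const.prodMk (measurable_const.prodMk measurable_id))

lemma measureReal_symmDiff_thetaBall (hθ : Continuous fun p : M × M => θ p.1 p.2)
    (hs : ∀ x y, θ x y = θ y x) (r : ℝ) (x y : M) :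
    μ.real (symmDiff (thetaBall θ r x) (thetaBall θ r y)) =
      ∫ z, |ballIndicator θ r x z - ballIndicator θ r y z| ∂μ := by
  have h : ∀ z, |ballIndicator θ r x z - ballIndicator θ r y z| =
      (symmDiff (thetaBall θ r x) (thetaBall θ r y)).indicator (fun _ => (1 : ℝ)) z := by
    intro z
    simp only [ballIndicator_eq_indicator hs, indicator]
    by_cases h1 : z ∈ thetaBall θ r x <;> by_cases h2 : z ∈ thetaBall θ r y <;>
      simp [mem_symmDiff, h1, h2]
  simp_rw [h]
  rw [integral_indicator ((measurableSet_thetaBall hθ r x).symmDiff (measurableSet_thetaBall hθ r y))]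
  simp

variable [IsProbabilityMeasure μ]

lemma integrable_of_measurable_of_bounded {α : Type*} [MeasurableSpace α] {ν : Measure α}
    [IsFiniteMeasure ν] {f : α → ℝ} (hf : Measurable f) (C : ℝ) (h : ∀ x, ‖f x‖ ≤ C) :
    Integrable f ν :=
  Integrable.of_bound hf.aestronglyMeasurable C (Filter.Eventually.of_forall h)

lemma integrable_ballIndicator (hθ : Continuous fun p : M × M => θ p.1 p.2) (r : ℝ) (x : M) :
    Integrable (ballIndicator θ r x) μ :=
  integrable_of_measurable_of_bounded (measurable_ballIndicator_right hθ r x) 1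
    fun _ => norm_ballIndicator_le ..

lemma integrable_ballIndicator_mul (hθ : Continuous fun p : M × M => θ p.1 p.2) (r : ℝ) (x y : M) :
    Integrable (fun z => ballIndicator θ r x z * ballIndicator θ r y z) μ :=
  integrable_of_measurable_of_bounded ((measurable_ballIndicator_right hθ r x).mul
    (measurable_ballIndicator_right hθ r y)) 1
    fun _ => by
      rw [norm_mul]
      exact mul_le_one₀ (norm_ballIndicator_le ..) (norm_nonneg _) (norm_ballIndicator_le ..)

/-- By Fubini the radius can be integrated first with z fixed, and the integral over radii is
elementary. This is the reason for the weight sin: it produces cos θ, which is affine in the inner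
product of the embedded points. -/
lemma symmDiffMetric_sin_eq (hθ : Continuous fun p : M × M => θ p.1 p.2)
    (hs : ∀ x y, θ x y = θ y x) (hr : ∀ x y, θ x y ∈ Icc 0 Real.pi) (x y : M) :
    symmDiffMetric θ μ Real.sin x y =
      1 / 2 * ∫ z, |Real.cos (θ x z) - Real.cos (θ y z)| ∂μ := by
  unfold symmDiffMetric
  simp_rw [measureReal_symmDiff_thetaBall hθ hs, mul_assoc, intervalIntegral.integral_const_mul,
    ← integral_mul_const]
  congr 1
  rw [intervalIntegral.integral_of_le Real.pi_pos.le, integral_integral_swap]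
  · refine integral_congr_ae (Filter.Eventually.of_forall fun z => ?_)
    simp only
    rw [← integral_abs_sub_step_mul_sin (hr x z) (hr y z),
      intervalIntegral.integral_of_le Real.pi_pos.le]
    simp only [ballIndicator]
  · refine integrable_of_measurable_of_bounded ?_ 1 ?_
    · have h : ∀ x, Measurable fun p : ℝ × M => ballIndicator θ p.1 x p.2 := fun x =>
        (measurable_ballIndicator hθ).comp
          (measurable_fst.prodMk (measurable_const.prodMk measurable_snd))
      exact (continuous_abs.measurable.comp ((h x).sub (h y))).mul
        (Real.measurable_sin.comp measurable_fst)
    · rintro ⟨r, z⟩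
      simp only [Function.uncurry, norm_mul, Real.norm_eq_abs, abs_abs]
      refine mul_le_one₀ ?_ (abs_nonneg _) (Real.abs_sin_le_one _)
      rw [abs_le]
      constructor <;> linarith [ballIndicator_nonneg θ r x z, ballIndicator_nonneg θ r y z,
        ballIndicator_le_one θ r x z, ballIndicator_le_one θ r y z]

/-- Integrate |1_A - 1_B| = 1_A + 1_B - 2·1_A·1_B, where A and B both have measure v. -/
lemma half_measureReal_symmDiff_thetaBall (hθ : Continuous fun p : M × M => θ p.1 p.2)
    (hs : ∀ x y, θ x y = θ y x) {r : ℝ} {v : ℝ} (hv : ∀ x, μ.real (thetaBall θ r x) = v) (x y : M) :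
    1 / 2 * μ.real (symmDiff (thetaBall θ r x) (thetaBall θ r y)) =
      v - ∫ z, ballIndicator θ r x z * ballIndicator θ r y z ∂μ := by
  rw [measureReal_symmDiff_thetaBall hθ hs]
  have h : ∀ z, |ballIndicator θ r x z - ballIndicator θ r y z| =
      ballIndicator θ r x z + ballIndicator θ r y z -
        2 * (ballIndicator θ r x z * ballIndicator θ r y z) := by
    intro z
    unfold ballIndicator; split_ifs <;> norm_num
  simp_rw [h]
  rw [integral_sub (f := fun z => ballIndicator θ r x z + ballIndicator θ r y z)
    ((integrable_ballIndicator hθ r x).add (integrable_ballIndicator hθ r y))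
    ((integrable_ballIndicator_mul hθ r x y).const_mul 2), integral_add
    (integrable_ballIndicator hθ r x) (integrable_ballIndicator hθ r y), integral_const_mul,
    integral_ballIndicator hθ hs, integral_ballIndicator hθ hs, hv, hv]
  ring

/-- Each pair contributes ∫ (1_A - v)(1_B - v) = μ(A ∩ B) - v², and the intersection is traded for
the symmetric difference. -/
lemma quadraticDiscrepancyAt_eq (hθ : Continuous fun p : M × M => θ p.1 p.2)
    (hs : ∀ x y, θ x y = θ y x) {N : ℕ} (D : Fin N → M) {r : ℝ} {v : ℝ}
    (hv : ∀ x, μ.real (thetaBall θ r x) = v) :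
    quadraticDiscrepancyAt θ μ D r = N ^ 2 * (v - v ^ 2) -
      ∑ i, ∑ j, 1 / 2 * μ.real (symmDiff (thetaBall θ r (D i)) (thetaBall θ r (D j))) := by
  unfold quadraticDiscrepancyAt
  simp_rw [localDiscrepancy_eq D hv, half_measureReal_symmDiff_thetaBall hθ hs hv, sq,
    Finset.sum_mul_sum]
  have hint : ∀ i j, Integrable (fun y => (ballIndicator θ r (D i) y - v) *
      (ballIndicator θ r (D j) y - v)) μ := by
    intro i j
    have : (fun y => (ballIndicator θ r (D i) y - v) * (ballIndicator θ r (D j) y - v)) = fun y =>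
      ballIndicator θ r (D i) y * ballIndicator θ r (D j) y - v * ballIndicator θ r (D i) y -
        v * ballIndicator θ r (D j) y + v * v := by ext y; ring
    rw [this]
    exact (((integrable_ballIndicator_mul hθ r _ _).sub
      ((integrable_ballIndicator hθ r _).const_mul v)).sub
      ((integrable_ballIndicator hθ r _).const_mul v)).add (integrable_const _)
  rw [integral_finsetSum _ fun i _ => integrable_finsetSum _ fun j _ => hint i j]
  have : ∀ i j, ∫ y, (ballIndicator θ r (D i) y - v) * (ballIndicator θ r (D j) y - v) ∂μ =
      (∫ y, ballIndicator θ r (D i) y * ballIndicator θ r (D j) y ∂μ) - v * v := by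
    intro i j
    have : (fun y => (ballIndicator θ r (D i) y - v) * (ballIndicator θ r (D j) y - v)) = fun y =>
      ballIndicator θ r (D i) y * ballIndicator θ r (D j) y - v * ballIndicator θ r (D i) y -
        v * ballIndicator θ r (D j) y + v * v := by ext y; ring
    have h1 := integrable_ballIndicator_mul (μ := μ) hθ r (D i) (D j)
    have h2 := fun i => (integrable_ballIndicator (μ := μ) hθ r (D i)).const_mul v
    have h3 : Integrable (fun y => ballIndicator θ r (D i) y * ballIndicator θ r (D j) y -
      v * ballIndicator θ r (D i) y) μ := h1.sub (h2 i)
    have h4 : Integrable (fun y => ballIndicator θ r (D i) y * ballIndicator θ r (D j) y -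
      v * ballIndicator θ r (D i) y - v * ballIndicator θ r (D j) y) μ := h3.sub (h2 j)
    rw [this, integral_add h4 (integrable_const _),
      integral_sub h3 (h2 j), integral_sub h1 (h2 i), integral_const_mul,
      integral_const_mul, integral_ballIndicator hθ hs, integral_ballIndicator hθ hs, hv, hv]
    simp
  have h3 : ∀ i, ∫ y, ∑ j, (ballIndicator θ r (D i) y - v) * (ballIndicator θ r (D j) y - v) ∂μ =
      ∑ j, ((∫ y, ballIndicator θ r (D i) y * ballIndicator θ r (D j) y ∂μ) - v * v) := by
    intro i
    rw [integral_finsetSum _ fun j _ => hint i j]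
    simp_rw [this]
  simp_rw [h3, Finset.sum_sub_distrib]
  simp
  ring

/-- Integrating over the centre y first, symmetry of θ turns y ↦ 1[θ(y, z) < r] into the indicator
of a ball about z, which gives a factor v for every z. -/
lemma integral_integral_ballIndicator_mul (hθ : Continuous fun p : M × M => θ p.1 p.2)
    (hs : ∀ x y, θ x y = θ y x) {r : ℝ} {v : ℝ}
    (hv : ∀ x, μ.real (thetaBall θ r x) = v) (x : M) :
    ∫ y, ∫ z, ballIndicator θ r x z * ballIndicator θ r y z ∂μ ∂μ = v ^ 2 := by
  rw [integral_integral_swap]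
  · have h : ∀ z, ∫ y, ballIndicator θ r x z * ballIndicator θ r y z ∂μ =
        v * ballIndicator θ r x z := by
      intro z
      have : ∀ y, ballIndicator θ r y z = ballIndicator θ r z y := fun y => by
        simp [ballIndicator, hs y z]
      simp_rw [integral_const_mul, this, integral_ballIndicator hθ hs, hv]
      ring
    simp_rw [h, integral_const_mul, integral_ballIndicator hθ hs, hv]
    ring
  · refine integrable_of_measurable_of_bounded ?_ 1 ?_
    · exact ((measurable_ballIndicator_right hθ r x).comp measurable_snd).mul
        ((measurable_ballIndicator hθ).comp (measurable_const.prodMk measurable_id))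
    · rintro ⟨y, z⟩
      simp only [Function.uncurry, norm_mul]
      exact mul_le_one₀ (norm_ballIndicator_le ..) (norm_nonneg _) (norm_ballIndicator_le ..)

/-- Monotonicity in the radius yields interval integrability without any continuity in r. -/
lemma monotone_integral_ballIndicator_mul (hθ : Continuous fun p : M × M => θ p.1 p.2) (x y : M) :
    Monotone fun r => ∫ z, ballIndicator θ r x z * ballIndicator θ r y z ∂μ := by
  intro r s h
  have hm : ∀ x z, ballIndicator θ r x z ≤ ballIndicator θ s x z := by
    intro x z
    unfold ballIndicator
    split_ifs with h1 h2
    · rfl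
    · exact absurd (h1.trans_le h) h2
    · norm_num
    · rfl
  exact integral_mono (integrable_ballIndicator_mul hθ r x y) (integrable_ballIndicator_mul hθ s x y)
    fun z => mul_le_mul (hm _ _) (hm _ _) (ballIndicator_nonneg ..) (ballIndicator_nonneg ..)

/-- `∫₀^π (v(r) - v(r)²) sin r dr`, where `v(r)` is the measure of a ball of radius `r`. -/
def meanSymmDiff (θ : M → M → ℝ) (μ : Measure M) (x : M) : ℝ :=
  ∫ r in (0 : ℝ)..Real.pi,
    (μ.real (thetaBall θ r x) - μ.real (thetaBall θ r x) ^ 2) * Real.sin r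

/-- For each r the mean over y of ½ μ(B_r(x) ∆ B_r(y)) is v - v², whatever x is. The point `x₀`
serves only to name v(r). -/
lemma integral_symmDiffMetric (hθ : Continuous fun p : M × M => θ p.1 p.2)
    (hs : ∀ x y, θ x y = θ y x)
    (hv : ∀ r x y, μ.real (thetaBall θ r x) = μ.real (thetaBall θ r y)) (x₀ x : M) :
    ∫ y, symmDiffMetric θ μ Real.sin x y ∂μ = meanSymmDiff θ μ x₀ := by
  unfold symmDiffMetric meanSymmDiff
  have key : ∀ r y, 1 / 2 * μ.real (symmDiff (thetaBall θ r x) (thetaBall θ r y)) =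
      μ.real (thetaBall θ r x₀) - ∫ z, ballIndicator θ r x z * ballIndicator θ r y z ∂μ :=
    fun r y => half_measureReal_symmDiff_thetaBall hθ hs (fun w => hv r w x₀) x y
  simp_rw [key, intervalIntegral.integral_of_le Real.pi_pos.le]
  have hjoint : Measurable fun p : M × ℝ =>
      ∫ z, ballIndicator θ p.2 x z * ballIndicator θ p.2 p.1 z ∂μ := by
    have h1 : Measurable fun q : (M × ℝ) × M =>
        ballIndicator θ q.1.2 x q.2 * ballIndicator θ q.1.2 q.1.1 q.2 :=
      ((measurable_ballIndicator hθ).comp ((measurable_snd.comp measurable_fst).prodMk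
        (measurable_const.prodMk measurable_snd))).mul
        ((measurable_ballIndicator hθ).comp ((measurable_snd.comp measurable_fst).prodMk
          ((measurable_fst.comp measurable_fst).prodMk measurable_snd)))
    exact h1.stronglyMeasurable.integral_prod_right.measurable
  rw [integral_integral_swap]
  · refine integral_congr_ae (Filter.Eventually.of_forall fun r => ?_)
    simp only
    rw [integral_mul_const, integral_sub (integrable_const _), integral_integral_ballIndicator_mul
      hθ hs (fun w => hv r w x₀)]
    · simp
    · refine integrable_of_measurable_of_bounded ?_ 1 fun y => ?_
      · exact hjoint.comp (measurable_id.prodMk measurable_const)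
      · rw [Real.norm_of_nonneg (integral_nonneg fun z => mul_nonneg (ballIndicator_nonneg ..)
          (ballIndicator_nonneg ..))]
        have := integral_mono (μ := μ) (integrable_ballIndicator_mul hθ r x y) (integrable_const 1)
          fun z => mul_le_one₀ (ballIndicator_le_one θ r x z) (ballIndicator_nonneg ..)
            (ballIndicator_le_one θ r y z)
        simpa using this
  · refine integrable_of_measurable_of_bounded ?_ 1 ?_
    · refine Measurable.mul (Measurable.sub ?_ hjoint) (Real.measurable_sin.comp measurable_snd)
      exact (monotone_measureReal_thetaBall θ x₀).measurable.comp measurable_snd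
    · rintro ⟨y, r⟩
      simp only [Function.uncurry, norm_mul]
      refine mul_le_one₀ ?_ (norm_nonneg _) (Real.abs_sin_le_one _)
      rw [← key, Real.norm_of_nonneg (by positivity)]
      have : μ.real (symmDiff (thetaBall θ r x) (thetaBall θ r y)) ≤ 1 := measureReal_le_one
      linarith

lemma intervalIntegrable_symmDiff (hθ : Continuous fun p : M × M => θ p.1 p.2)
    (hs : ∀ x y, θ x y = θ y x)
    (hv : ∀ r x y, μ.real (thetaBall θ r x) = μ.real (thetaBall θ r y)) (x y : M) :
    IntervalIntegrable (fun r => (1 / 2 * μ.real (symmDiff (thetaBall θ r x) (thetaBall θ r y))) *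
      Real.sin r) volume 0 Real.pi := by
  simp_rw [half_measureReal_symmDiff_thetaBall hθ hs (fun w => hv _ w x)]
  exact ((monotone_measureReal_thetaBall θ x).intervalIntegrable.sub
    (monotone_integral_ballIndicator_mul hθ x y).intervalIntegrable).mul_continuousOn
    Real.continuous_sin.continuousOn

/-- The identity `λ[η, D] + θ^Δ(η)[D] = ⟨θ^Δ(η)⟩ N²`. -/
lemma quadraticDiscrepancy_sin_eq (hθ : Continuous fun p : M × M => θ p.1 p.2)
    (hs : ∀ x y, θ x y = θ y x)
    (hv : ∀ r x y, μ.real (thetaBall θ r x) = μ.real (thetaBall θ r y)) (x₀ : M)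
    {N : ℕ} (D : Fin N → M) :
    quadraticDiscrepancy θ μ Real.sin D =
      N ^ 2 * meanSymmDiff θ μ x₀ - distanceSum (symmDiffMetric θ μ Real.sin) D := by
  unfold quadraticDiscrepancy distanceSum symmDiffMetric meanSymmDiff
  simp_rw [quadraticDiscrepancyAt_eq hθ hs D (fun w => hv _ w x₀), sub_mul (_ * _),
    Finset.sum_mul, mul_assoc ((N : ℝ) ^ 2)]
  have hi := fun i j => intervalIntegrable_symmDiff (μ := μ) hθ hs hv (D i) (D j)
  have hm := monotone_measureReal_thetaBall (μ := μ) θ x₀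
  have hm2 : Monotone fun r => μ.real (thetaBall θ r x₀) ^ 2 := fun a b h =>
    pow_le_pow_left₀ measureReal_nonneg (hm h) 2
  rw [intervalIntegral.integral_sub]
  · rw [intervalIntegral.integral_const_mul, intervalIntegral.integral_finsetSum]
    · congr 2
      ext i
      rw [intervalIntegral.integral_finsetSum]
      exact fun j _ => hi i j
    · intro i _
      simpa only [Finset.sum_apply, Finset.sum_fn] using IntervalIntegrable.sum Finset.univ fun j _ => hi i j
  · exact ((hm.intervalIntegrable.sub hm2.intervalIntegrable).mul_continuousOn
      Real.continuous_sin.continuousOn).const_mul _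
  · simpa only [Finset.sum_apply, Finset.sum_fn] using IntervalIntegrable.sum Finset.univ fun i _ => IntervalIntegrable.sum Finset.univ fun j _ => hi i j

/-- Stolarsky's invariance principle on a space where the symmetric difference metric is
proportional to `τ`. -/
theorem stolarsky_of_proportional [Nonempty M] (hθ : Continuous fun p : M × M => θ p.1 p.2)
    (hs : ∀ x y, θ x y = θ y x)
    (hv : ∀ r x y, μ.real (thetaBall θ r x) = μ.real (thetaBall θ r y))
    {τ : M → M → ℝ} {c : ℝ} (hc : 0 < c)
    (hτ : ∀ x y, symmDiffMetric θ μ Real.sin x y = c * τ x y)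
    (hτ1 : ∀ x y, τ x y ≤ 1)
    (hτpos : ∀ x, 0 < ∫ y, τ x y ∂μ) (hdiam : 0 < diameter τ) :
    averageDistance μ τ / averageDistance μ (symmDiffMetric θ μ Real.sin) =
      diameter τ / diameter (symmDiffMetric θ μ Real.sin) ∧
    ∀ N : ℕ, (∀ D : Fin N → M,
      averageDistance μ τ / averageDistance μ (symmDiffMetric θ μ Real.sin) *
        quadraticDiscrepancy θ μ Real.sin D + distanceSum τ D
          = averageDistance μ τ * (N : ℝ) ^ 2) ∧
      averageDistance μ τ / averageDistance μ (symmDiffMetric θ μ Real.sin) *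
        extremalDiscrepancy θ μ Real.sin N + extremalDistanceSum τ N
        = averageDistance μ τ * (N : ℝ) ^ 2 := by
  obtain ⟨x₀⟩ := ‹Nonempty M›
  have hτ' : symmDiffMetric θ μ Real.sin = fun x y => c * τ x y := by
    ext x y; exact hτ x y
  -- Proportionality makes the inner integral of τ independent of x as well, so no separate
  -- homogeneity of τ is needed.
  have hA : ∀ x, c * ∫ y, τ x y ∂μ = meanSymmDiff θ μ x₀ := by
    intro x
    rw [← integral_symmDiffMetric hθ hs hv x₀ x, ← integral_const_mul, hτ']
  have hA0 : 0 < meanSymmDiff θ μ x₀ := by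
    rw [← hA x₀]; exact mul_pos hc (hτpos x₀)
  have hav : averageDistance μ τ = meanSymmDiff θ μ x₀ / c := by
    unfold averageDistance
    have : ∀ x, ∫ y, τ x y ∂μ = meanSymmDiff θ μ x₀ / c := fun x => by
      rw [← hA x]; field_simp
    simp [this]
  have hav' : averageDistance μ (symmDiffMetric θ μ Real.sin) = meanSymmDiff θ μ x₀ := by
    unfold averageDistance
    simp [integral_symmDiffMetric hθ hs hv x₀]
  have hg : averageDistance μ τ / averageDistance μ (symmDiffMetric θ μ Real.sin) = 1 / c := by
    rw [hav, hav']; field_simp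
  have hid : ∀ {N : ℕ} (D : Fin N → M), 1 / c * quadraticDiscrepancy θ μ Real.sin D +
      distanceSum τ D = averageDistance μ τ * (N : ℝ) ^ 2 := by
    intro N D
    rw [quadraticDiscrepancy_sin_eq hθ hs hv x₀ D, hav, hτ']
    have : distanceSum (fun x y => c * τ x y) D = c * distanceSum τ D := by
      simp [distanceSum, Finset.mul_sum]
    rw [this]
    field_simp
    ring
  rw [hg]
  refine ⟨?_, fun N => ⟨hid, ?_⟩⟩
  · have : diameter (symmDiffMetric θ μ Real.sin) = c * diameter τ := by
      unfold diameter
      rw [hτ', Real.mul_iSup_of_nonneg hc.le]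
    rw [this]
    field_simp
  -- The real infimum and supremum are meaningful only for bounded ranges; the bound comes from τ ≤
  -- 1.
  · have hbdd : BddAbove (range fun D : Fin N → M => distanceSum τ D) := by
      refine ⟨∑ _i : Fin N, ∑ _j : Fin N, 1, ?_⟩
      rintro _ ⟨D, rfl⟩
      exact Finset.sum_le_sum fun i _ => Finset.sum_le_sum fun j _ => hτ1 _ _
    have : Nonempty (Fin N → M) := ⟨fun _ => x₀⟩
    -- λ is a decreasing affine function of the sum of distances, so its infimum corresponds to
    -- their supremum.
    have hl : ∀ D : Fin N → M, quadraticDiscrepancy θ μ Real.sin D =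
        c * (averageDistance μ τ * (N : ℝ) ^ 2 - distanceSum τ D) := by
      intro D
      rw [← hid D]; field_simp; ring
    have hbelow : BddBelow (range fun D : Fin N → M => quadraticDiscrepancy θ μ Real.sin D) := by
      obtain ⟨B, hB⟩ := hbdd
      refine ⟨c * (averageDistance μ τ * (N : ℝ) ^ 2 - B), ?_⟩
      rintro _ ⟨D, rfl⟩
      simp only [hl]
      exact mul_le_mul_of_nonneg_left (sub_le_sub_left (hB ⟨D, rfl⟩) _) hc.le
    unfold extremalDiscrepancy extremalDistanceSum
    apply le_antisymm
    · rw [← le_sub_iff_add_le']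
      refine ciSup_le fun D => ?_
      have := ciInf_le hbelow D
      have h1 := hid D
      have h2 := mul_le_mul_of_nonneg_left this (one_div_pos.2 hc).le
      linarith
    · rw [← sub_le_iff_le_add]
      have : c * (averageDistance μ τ * (N : ℝ) ^ 2 - ⨆ D : Fin N → M, distanceSum τ D) ≤
          ⨅ D : Fin N → M, quadraticDiscrepancy θ μ Real.sin D := by
        refine le_ciInf fun D => ?_
        rw [hl]
        exact mul_le_mul_of_nonneg_left (sub_le_sub_left (le_ciSup hbdd D) _) hc.le
      have h2 := mul_le_mul_of_nonneg_left this (one_div_pos.2 hc).le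
      rw [← mul_assoc, one_div_mul_cancel hc.ne', one_mul] at h2
      exact h2

end Stolarsky

/-! ### Symmetries and Hausdorff measure of subsets of a Euclidean space. -/

/-- Normalized `d`-dimensional Hausdorff measure on `P`. -/
def normalizedHausdorff {V : Type} [NormedAddCommGroup V] [MeasurableSpace V]
    [BorelSpace V] (P : Set V) (d : ℝ) : Measure P := (μH[d] (univ : Set P))⁻¹ • μH[d]

/-- The inclusion of P is an isometry, so the total mass of P as a metric space is its Hausdorff
measure as a subset of V. -/
lemma isProbabilityMeasure_normalizedHausdorff {V : Type} [NormedAddCommGroup V]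
    [MeasurableSpace V] [BorelSpace V] {P : Set V} {d : ℝ} (hd : 0 ≤ d) (h0 : μH[d] P ≠ 0)
    (h1 : μH[d] P ≠ ⊤) : IsProbabilityMeasure (normalizedHausdorff P d) := by
  have h : μH[d] (univ : Set P) = μH[d] P := by
    have := (isometry_subtype_coe (s := P)).hausdorffMeasure_image (Or.inl hd) (univ : Set P)
    rw [image_univ, Subtype.range_coe] at this
    exact this.symm
  refine ⟨?_⟩
  simp only [normalizedHausdorff, Measure.smul_apply, h, smul_eq_mul]
  exact ENNReal.inv_mul_cancel h0 h1

section Embedded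

open Filter Topology

variable {V : Type} [NormedAddCommGroup V] [InnerProductSpace ℝ V]

/-- The linear isometries of the ambient space that preserve `P`. -/
def symmetryGroup (P : Set V) : Subgroup (V ≃ₗᵢ[ℝ] V) where
  carrier := {g | ∀ x, g x ∈ P ↔ x ∈ P}
  mul_mem' {f g} hf hg x := (hf (g x)).trans (hg x)
  one_mem' _ := Iff.rfl
  inv_mem' {f} hf x := by
    rw [← hf]
    exact iff_of_eq (congrArg (· ∈ P) (f.apply_symm_apply x))

lemma mem_symmetryGroup_of_maps {P : Set V} {g : V ≃ₗᵢ[ℝ] V} (h : ∀ x ∈ P, g x ∈ P)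
    (h' : ∀ x ∈ P, g.symm x ∈ P) : g ∈ symmetryGroup P :=
  fun x => ⟨fun hx => by simpa using h' _ hx, h x⟩

/-- A symmetry of the ambient space restricts to an isometry of `P`. -/
def restrictSymmetry {P : Set V} (g : V ≃ₗᵢ[ℝ] V) (hg : g ∈ symmetryGroup P) : P ≃ᵢ P where
  toEquiv := g.toEquiv.subtypeEquiv fun x => (hg x).symm
  isometry_toFun := fun x y => g.isometry (x : V) y

@[simp] lemma coe_restrictSymmetry {P : Set V} (g : V ≃ₗᵢ[ℝ] V) (hg : g ∈ symmetryGroup P)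
    (x : P) : (restrictSymmetry g hg x : V) = g x := rfl

section Hausdorff

variable [MeasurableSpace V] [BorelSpace V]

/-- A compact homogeneous set with a local chart on a `d`-dimensional space has positive and finite
`d`-dimensional Hausdorff measure. -/
theorem hausdorffMeasure_pos_and_lt_top {W : Type} [NormedAddCommGroup W] [InnerProductSpace ℝ W]
    [FiniteDimensional ℝ W] {P : Set V} (hP : IsCompact P) {x₀ : V}
    (htrans : ∀ x ∈ P, ∃ g ∈ symmetryGroup P, g x = x₀) (p : V →L[ℝ] W) (φ : W → V)
    (hφ : ContDiffAt ℝ 1 φ (p x₀)) (hφP : ∀ᶠ w in 𝓝 (p x₀), φ w ∈ P ∧ p (φ w) = w)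
    (hφp : ∀ᶠ x in 𝓝[P] x₀, φ (p x) = x) :
    μH[(Module.finrank ℝ W : ℝ)] P ≠ 0 ∧ μH[(Module.finrank ℝ W : ℝ)] P ≠ ⊤ := by
  let : MeasurableSpace W := borel W
  have : BorelSpace W := ⟨rfl⟩
  have hd : (0 : ℝ) ≤ Module.finrank ℝ W := by positivity
  constructor
  -- The projection p is Lipschitz, so a null P would have a null image; but the section φ shows
  -- that the image contains a neighbourhood of p x₀ in W.
  · intro h0
    have h1 : (μH[(Module.finrank ℝ W : ℝ)] : Measure W) (p '' P) = 0 := by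
      have := p.lipschitz.hausdorffMeasure_image_le hd P
      rw [h0, mul_zero] at this
      exact le_antisymm this bot_le
    have h2 : p '' P ∈ 𝓝 (p x₀) := hφP.mono fun w hw => ⟨φ w, hw.1, hw.2⟩
    exact (Measure.measure_pos_of_mem_nhds _ h2).ne' h1
  -- By compactness it suffices to bound the measure near each point. A symmetry brings the point to
  -- x₀, where P is locally the image of a ball under the Lipschitz map φ.
  · refine (hP.measure_lt_top_of_nhdsWithin fun x hx => ?_).ne
    obtain ⟨g, hg, hgx⟩ := htrans x hx
    obtain ⟨K, t, ht, hKt⟩ := hφ.exists_lipschitzOnWith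
    have hfin : μH[(Module.finrank ℝ W : ℝ)] (φ '' (t ∩ Metric.ball (p x₀) 1)) < ⊤ := by
      refine ((hKt.mono inter_subset_left).hausdorffMeasure_image_le hd).trans_lt ?_
      refine ENNReal.mul_lt_top (ENNReal.rpow_lt_top_of_nonneg hd ENNReal.coe_ne_top) ?_
      exact (measure_mono inter_subset_right).trans_lt measure_ball_lt_top
    refine ⟨g ⁻¹' (φ '' (t ∩ Metric.ball (p x₀) 1)), ?_, ?_⟩
    · have h1 : φ '' (t ∩ Metric.ball (p x₀) 1) ∈ 𝓝[P] x₀ := by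
        have h2 : ∀ᶠ x in 𝓝[P] x₀, p x ∈ t ∩ Metric.ball (p x₀) 1 :=
          (p.continuous.continuousAt.mono_left nhdsWithin_le_nhds).eventually
            (inter_mem ht (Metric.ball_mem_nhds _ one_pos))
        filter_upwards [h2, hφp] with x hx hx'
        exact ⟨p x, hx, hx'⟩
      have h3 : Tendsto g (𝓝[P] x) (𝓝[P] x₀) := by
        rw [← hgx]
        exact g.continuous.continuousWithinAt.tendsto_nhdsWithin fun y hy => (hg y).2 hy
      exact h3 h1
    · have := g.toIsometryEquiv.hausdorffMeasure_preimage (Module.finrank ℝ W : ℝ)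
        (φ '' (t ∩ Metric.ball (p x₀) 1))
      exact lt_of_eq_of_lt this hfin

end Hausdorff

/-! ### The invariance principle for compact homogeneous subsets of a Euclidean unit sphere. -/

section Invariant

variable [MeasurableSpace V] [BorelSpace V] {P : Set V}

lemma measurePreserving_restrictSymmetry (d : ℝ) (g : V ≃ₗᵢ[ℝ] V) (hg : g ∈ symmetryGroup P) :
    MeasurePreserving (restrictSymmetry g hg) (normalizedHausdorff P d)
      (normalizedHausdorff P d) :=
  ((restrictSymmetry g hg).measurePreserving_hausdorffMeasure d).smul_measure _

/-- If a nonempty open set were null, its images under symmetries would give every point a null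
neighbourhood, and by compactness P would be null. -/
lemma isOpenPosMeasure_normalizedHausdorff (hP : IsCompact P) {d : ℝ}
    [IsProbabilityMeasure (normalizedHausdorff P d)]
    (htrans : ∀ x ∈ P, ∀ y ∈ P, ∃ g ∈ symmetryGroup P, g x = y) :
    (normalizedHausdorff P d).IsOpenPosMeasure := by
  have : CompactSpace P := isCompact_iff_compactSpace.1 hP
  refine ⟨fun U hU ⟨y, hy⟩ h0 => ?_⟩
  have : normalizedHausdorff P d univ = 0 := by
    refine isCompact_univ.measure_zero_of_nhdsWithin fun x _ => ?_
    obtain ⟨g, hg, hgx⟩ := htrans x x.2 y y.2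
    refine ⟨restrictSymmetry g hg ⁻¹' U, ?_, ?_⟩
    · rw [nhdsWithin_univ]
      refine (hU.preimage (restrictSymmetry g hg).continuous).mem_nhds ?_
      rw [mem_preimage]
      convert hy
      exact Subtype.ext hgx
    · rw [(measurePreserving_restrictSymmetry d g hg).measure_preimage
        hU.measurableSet.nullMeasurableSet, h0]
  simp at this

/-- Substitute z ↦ g z, which preserves both the measure on P and the inner product. -/
lemma integral_abs_inner_map (d : ℝ) (g : V ≃ₗᵢ[ℝ] V) (hg : g ∈ symmetryGroup P) (u : V) :
    ∫ z : P, |inner ℝ (g u) (z : V)| ∂normalizedHausdorff P d =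
      ∫ z : P, |inner ℝ u (z : V)| ∂normalizedHausdorff P d := by
  have := (measurePreserving_restrictSymmetry d g hg).integral_comp
    (restrictSymmetry g hg).toHomeomorph.measurableEmbedding
    (fun z : P => |inner ℝ (g u) (z : V)|)
  rw [← this]
  simp

/-- Stolarsky's invariance principle for a compact subset of the unit sphere on which the cosine of
the distance is an affine function of the inner product, and whose chords are all symmetric to
multiples of one vector. -/
theorem stolarsky_of_embedded (hP : IsCompact P) {d κ b : ℝ} (hd : 0 ≤ d)
    (h0 : μH[d] P ≠ 0) (h1 : μH[d] P ≠ ⊤)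
    (hnorm : ∀ x ∈ P, ‖x‖ = 1) (hκ : 0 < κ) (hκb : κ + b = 1)
    (hrange : ∀ x ∈ P, ∀ y ∈ P, -1 ≤ κ * inner ℝ x y + b)
    (htrans : ∀ x ∈ P, ∀ y ∈ P, ∃ g ∈ symmetryGroup P, g x = y)
    (e : V) (he : ∀ x ∈ P, ∀ y ∈ P, ∃ g ∈ symmetryGroup P, g (x - y) = ‖x - y‖ • e)
    (hne : P.Nontrivial) (θ : P → P → ℝ)
    (hθ : ∀ x y : P, θ x y = Real.arccos (κ * inner ℝ (x : V) y + b))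
    (μ : Measure P) (hμ : μ = normalizedHausdorff P d)
    (τ : P → P → ℝ) (hτ : ∀ x y, τ x y = Real.sin (θ x y / 2)) :
    averageDistance μ τ / averageDistance μ (symmDiffMetric θ μ Real.sin) =
      diameter τ / diameter (symmDiffMetric θ μ Real.sin) ∧
    ∀ N : ℕ, (∀ D : Fin N → P,
      averageDistance μ τ / averageDistance μ (symmDiffMetric θ μ Real.sin) *
        quadraticDiscrepancy θ μ Real.sin D + distanceSum τ D
          = averageDistance μ τ * (N : ℝ) ^ 2) ∧
      averageDistance μ τ / averageDistance μ (symmDiffMetric θ μ Real.sin) *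
        extremalDiscrepancy θ μ Real.sin N + extremalDistanceSum τ N
        = averageDistance μ τ * (N : ℝ) ^ 2 := by
  subst hμ
  have : CompactSpace P := isCompact_iff_compactSpace.1 hP
  have := isProbabilityMeasure_normalizedHausdorff hd h0 h1
  have := isOpenPosMeasure_normalizedHausdorff (d := d) hP htrans
  obtain ⟨x₀, hx₀, y₀, hy₀, hxy₀⟩ := hne
  have : Nonempty P := ⟨⟨x₀, hx₀⟩⟩
  have hle : ∀ x y : P, κ * inner ℝ (x : V) y + b ≤ 1 := by
    intro x y
    have := real_inner_le_norm (x : V) y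
    rw [hnorm x x.2, hnorm y y.2] at this
    nlinarith
  have hcos : ∀ x y : P, Real.cos (θ x y) = κ * inner ℝ (x : V) y + b := fun x y => by
    rw [hθ, Real.cos_arccos (hrange x x.2 y y.2) (hle x y)]
  have hcont : Continuous fun p : P × P => θ p.1 p.2 := by
    simp_rw [hθ]
    exact Real.continuous_arccos.comp (by fun_prop)
  have hs : ∀ x y, θ x y = θ y x := fun x y => by rw [hθ, hθ, real_inner_comm]
  have hr : ∀ x y, θ x y ∈ Icc 0 Real.pi := fun x y => by
    rw [hθ]; exact ⟨Real.arccos_nonneg _, Real.arccos_le_pi _⟩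
  have hdist : ∀ x y : P, ‖(x : V) - y‖ ^ 2 = 2 * (1 - inner ℝ (x : V) y) := fun x y => by
    rw [norm_sub_sq_real, hnorm x x.2, hnorm y y.2]; ring
  -- The half-angle formula gives τ² = (1 - cos θ)/2, and κ + b = 1 turns this into κ(1 - ⟨x, y⟩)/2
  -- = κ‖x - y‖²/4.
  have hτd : ∀ x y, τ x y = Real.sqrt κ / 2 * ‖(x : V) - y‖ := by
    intro x y
    have h2 : 0 ≤ τ x y := by
      rw [hτ]
      exact Real.sin_nonneg_of_nonneg_of_le_pi (by linarith [(hr x y).1])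
        (by linarith [(hr x y).2, Real.pi_pos])
    refine (sq_eq_sq₀ h2 (by positivity)).1 ?_
    rw [mul_pow, hdist, div_pow, Real.sq_sqrt hκ.le, hτ, Real.sin_sq_eq_half_sub,
      mul_div_cancel₀ _ (two_ne_zero' ℝ), hcos]
    linear_combination (-1 / 2) * hκb
  have hτcont : ∀ x, Continuous (τ x) := fun x => by
    have : τ x = fun y : P => Real.sqrt κ / 2 * ‖(x : V) - y‖ := funext fun y => hτd x y
    rw [this]
    fun_prop
  have hsqrt : 0 < Real.sqrt κ := Real.sqrt_pos.2 hκ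
  have hτ1 : ∀ x y, τ x y ≤ 1 := fun x y => by rw [hτ]; exact Real.sin_le_one _
  have hτne : ∀ x y : P, x ≠ y → 0 < τ x y := fun x y h => by
    rw [hτd]
    have : 0 < ‖(x : V) - y‖ := norm_pos_iff.2 (sub_ne_zero.2 fun h' => h (Subtype.ext h'))
    positivity
  -- The heart of the argument: a symmetry aligns the chord with e, and homogeneity of |⟨·, z⟩|
  -- extracts its length.
  have hint : ∀ x y : P, ∫ z : P, |inner ℝ ((x : V) - y) (z : V)| ∂normalizedHausdorff P d =
      ‖(x : V) - y‖ * ∫ z : P, |inner ℝ e (z : V)| ∂normalizedHausdorff P d := by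
    intro x y
    obtain ⟨g, hg, hgxy⟩ := he x x.2 y y.2
    rw [← integral_abs_inner_map d g hg, hgxy, ← integral_const_mul]
    simp_rw [inner_smul_left, abs_mul]
    simp
  -- At z = x₀ the integrand for the chord x₀ - y₀ is 1 - ⟨x₀, y₀⟩ = ‖x₀ - y₀‖²/2 > 0, and the
  -- measure charges open sets.
  have hC : 0 < ∫ z : P, |inner ℝ e (z : V)| ∂normalizedHausdorff P d := by
    have h3 : 0 < ∫ z : P, |inner ℝ (x₀ - y₀) (z : V)| ∂normalizedHausdorff P d := by
      refine Continuous.integral_pos_of_hasCompactSupport_nonneg_nonzero (x := ⟨x₀, hx₀⟩)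
        (by fun_prop) (HasCompactSupport.of_compactSpace _) (fun _ => abs_nonneg _) ?_
      have := hdist ⟨x₀, hx₀⟩ ⟨y₀, hy₀⟩
      simp only at this
      have h4 : 0 < ‖x₀ - y₀‖ := norm_pos_iff.2 (sub_ne_zero.2 hxy₀)
      rw [abs_ne_zero, inner_sub_left, real_inner_self_eq_norm_sq, hnorm x₀ hx₀, real_inner_comm]
      nlinarith
    rw [hint ⟨x₀, hx₀⟩ ⟨y₀, hy₀⟩] at h3
    exact pos_of_mul_pos_right h3 (norm_nonneg _)
  -- With C the integral for e, θ^Δ = ½κC‖x - y‖ and τ = (√κ/2)‖x - y‖; their ratio is √κ·C.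
  refine stolarsky_of_proportional
    (c := Real.sqrt κ * ∫ z : P, |inner ℝ e (z : V)| ∂normalizedHausdorff P d)
    hcont hs ?_ (by positivity) ?_ hτ1 ?_ ?_
  · intro r x y
    obtain ⟨g, hg, hgx⟩ := htrans x x.2 y y.2
    rw [← (measurePreserving_restrictSymmetry d g hg).measureReal_preimage
      (measurableSet_thetaBall hcont r y).nullMeasurableSet]
    congr 1
    ext z
    simp only [thetaBall, mem_preimage, mem_ofPred_eq, hθ, coe_restrictSymmetry, ← hgx,
      g.inner_map_map]
  · intro x y
    rw [symmDiffMetric_sin_eq hcont hs hr, hτd]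
    have : ∀ z : P, |Real.cos (θ x z) - Real.cos (θ y z)| =
        κ * |inner ℝ ((x : V) - y) (z : V)| := fun z => by
      rw [hcos, hcos, inner_sub_left, ← abs_of_pos hκ, ← abs_mul, abs_of_pos hκ]
      ring_nf
    simp_rw [this]
    rw [integral_const_mul, hint]
    nth_rewrite 1 [← Real.mul_self_sqrt hκ.le]
    ring
  · intro x
    obtain ⟨y, hy⟩ : ∃ y : P, x ≠ y := by
      by_cases h : (x : V) = x₀
      · exact ⟨⟨y₀, hy₀⟩, fun h' => hxy₀ (h.symm.trans (congrArg Subtype.val h'))⟩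
      · exact ⟨⟨x₀, hx₀⟩, fun h' => h (congrArg Subtype.val h')⟩
    refine Continuous.integral_pos_of_hasCompactSupport_nonneg_nonzero (x := y)
      (hτcont x) (HasCompactSupport.of_compactSpace _) (fun z => ?_) (hτne x y hy).ne'
    simp only [Pi.zero_apply, hτd]
    positivity
  · refine (hτne ⟨x₀, hx₀⟩ ⟨y₀, hy₀⟩ fun h => hxy₀ (congrArg Subtype.val h)).trans_le ?_
    refine le_ciSup (f := fun p : P × P => τ p.1 p.2) ⟨1, ?_⟩ (⟨x₀, hx₀⟩, ⟨y₀, hy₀⟩)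
    rintro _ ⟨p, rfl⟩
    exact hτ1 _ _

end Invariant

end Embedded

/-! ### Spheres. -/

section Sphere

open Filter Topology

variable {V : Type} [NormedAddCommGroup V] [InnerProductSpace ℝ V]

/-- This one reflection serves twice: for transitivity on the sphere and for aligning chords. -/
lemma exists_linearIsometryEquiv_of_norm_eq [FiniteDimensional ℝ V] {v w : V} (h : ‖v‖ = ‖w‖) :
    ∃ g : V ≃ₗᵢ[ℝ] V, g v = w :=
  ⟨Submodule.reflection (ℝ ∙ (v - w))ᗮ, Submodule.reflection_sub h⟩

lemma mem_symmetryGroup_sphere (g : V ≃ₗᵢ[ℝ] V) :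
    g ∈ symmetryGroup (Metric.sphere (0 : V) 1) := fun x => by simp

/-- The coordinates of a vector other than the zeroth one. -/
def sphereProjection (d : ℕ) : EuclideanSpace ℝ (Fin (d + 1)) →L[ℝ] EuclideanSpace ℝ (Fin d) :=
  LinearMap.toContinuousLinearMap
    { toFun := fun x => WithLp.toLp 2 fun i => x i.succ
      map_add' := fun _ _ => rfl
      map_smul' := fun _ _ => rfl }

lemma sphereProjection_apply {d : ℕ} (x : EuclideanSpace ℝ (Fin (d + 1))) (i : Fin d) :
    sphereProjection d x i = x i.succ := rfl

/-- The upper hemisphere as a graph. -/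
def sphereChart (d : ℕ) (w : EuclideanSpace ℝ (Fin d)) : EuclideanSpace ℝ (Fin (d + 1)) :=
  WithLp.toLp 2 (Fin.cons (Real.sqrt (1 - ‖w‖ ^ 2)) w)

/-- Near the pole e₀ the sphere is the graph of √(1 - ‖w‖²) over the other coordinates, smooth at w
= 0 because the radicand there is 1. -/
lemma hausdorffMeasure_sphere (d : ℕ)
    [MeasurableSpace (EuclideanSpace ℝ (Fin (d + 1)))] [BorelSpace (EuclideanSpace ℝ (Fin (d + 1)))] :
    μH[(d : ℝ)] (Metric.sphere (0 : EuclideanSpace ℝ (Fin (d + 1))) 1) ≠ 0 ∧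
    μH[(d : ℝ)] (Metric.sphere (0 : EuclideanSpace ℝ (Fin (d + 1))) 1) ≠ ⊤ := by
  have hp0 : sphereProjection d (EuclideanSpace.single 0 1) = 0 := by
    ext i; simp [sphereProjection_apply, Fin.succ_ne_zero]
  have h := hausdorffMeasure_pos_and_lt_top (x₀ := EuclideanSpace.single 0 1)
    (isCompact_sphere (0 : EuclideanSpace ℝ (Fin (d + 1))) 1) (fun x hx => ?_)
    (sphereProjection d) (sphereChart d) ?_ ?_ ?_
  · simpa using h
  · obtain ⟨g, hg⟩ := exists_linearIsometryEquiv_of_norm_eq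
      (v := x) (w := EuclideanSpace.single 0 1) (by simpa using hx)
    exact ⟨g, mem_symmetryGroup_sphere g, hg⟩
  · rw [hp0]
    unfold sphereChart
    refine (PiLp.contDiff_toLp (p := 2)).contDiffAt.comp _ ?_
    refine contDiffAt_pi.2 fun i => ?_
    refine Fin.cases ?_ (fun j => ?_) i
    · simp only [Fin.cons_zero]
      refine ContDiffAt.sqrt ?_ (by simp)
      exact contDiffAt_const.sub (contDiff_norm_sq ℝ).contDiffAt
    · simp only [Fin.cons_succ]
      exact (contDiff_euclidean.1 contDiff_id j).contDiffAt
  · rw [hp0]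
    filter_upwards [Metric.ball_mem_nhds (0 : EuclideanSpace ℝ (Fin d)) one_pos] with w hw
    rw [mem_ball_zero_iff] at hw
    refine ⟨?_, ?_⟩
    · rw [mem_sphere_zero_iff_norm, EuclideanSpace.norm_eq, Real.sqrt_eq_one, Fin.sum_univ_succ]
      have h2 : 0 ≤ 1 - ‖w‖ ^ 2 := by nlinarith [norm_nonneg w]
      simp only [sphereChart, Fin.cons_zero, Fin.cons_succ, Real.norm_eq_abs, sq_abs,
        Real.sq_sqrt h2]
      rw [EuclideanSpace.real_norm_sq_eq]
      ring
    · ext i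
      simp [sphereProjection_apply, sphereChart]
  · have h1 : ∀ᶠ x : EuclideanSpace ℝ (Fin (d + 1)) in
        𝓝[Metric.sphere 0 1] (EuclideanSpace.single 0 1), 0 < x 0 := by
      refine nhdsWithin_le_nhds ?_
      have hc : Continuous fun x : EuclideanSpace ℝ (Fin (d + 1)) => x 0 := by fun_prop
      exact hc.continuousAt.eventually (lt_mem_nhds (by simp))
    filter_upwards [h1, self_mem_nhdsWithin] with x hx hxP
    rw [mem_sphere_zero_iff_norm] at hxP
    have h2 := EuclideanSpace.real_norm_sq_eq x
    rw [hxP, Fin.sum_univ_succ] at h2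
    ext i
    refine Fin.cases ?_ (fun j => ?_) i
    · simp only [sphereChart, Fin.cons_zero, EuclideanSpace.real_norm_sq_eq, sphereProjection_apply]
      rw [Real.sqrt_eq_iff_mul_self_eq_of_pos hx]
      linarith
    · simp [sphereChart, sphereProjection_apply]

/-- The conclusion of the invariance principle for the space `Q`. -/
def TwoPointSpace.InvariancePrinciple (Q : TwoPointSpace) : Prop :=
  Q.gamma = diameter Q.tau / diameter (symmDiffMetric Q.theta Q.mu Real.sin) ∧
    ∀ N : ℕ,
      (∀ D : Fin N → Q.Carrier,
        Q.gamma * quadraticDiscrepancy Q.theta Q.mu Real.sin D + distanceSum Q.tau D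
          = averageDistance Q.mu Q.tau * (N : ℝ) ^ 2) ∧
      Q.gamma * extremalDiscrepancy Q.theta Q.mu Real.sin N + extremalDistanceSum Q.tau N
        = averageDistance Q.mu Q.tau * (N : ℝ) ^ 2

/-- Here cos θ is the inner product itself, so κ = 1 and b = 0, and every linear isometry of the
ambient space is a symmetry. -/
theorem invariancePrinciple_sphere (d : ℕ) (hd : 1 ≤ d) :
    (TwoPointSpace.sphere d hd).InvariancePrinciple := by
  have hH := @hausdorffMeasure_sphere d
    (TwoPointSpace.instMeasurableSpaceAmbient (TwoPointSpace.sphere d hd))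
    (TwoPointSpace.instBorelSpaceAmbient (TwoPointSpace.sphere d hd))
  have he0 : ‖EuclideanSpace.single (0 : Fin (d + 1)) (1 : ℝ)‖ = 1 := by simp
  exact @stolarsky_of_embedded (EuclideanSpace ℝ (Fin (d + 1))) _ _
    (TwoPointSpace.instMeasurableSpaceAmbient (TwoPointSpace.sphere d hd))
    (TwoPointSpace.instBorelSpaceAmbient (TwoPointSpace.sphere d hd))
    (Metric.sphere 0 1) (isCompact_sphere _ _) (d : ℝ) 1 0 (by positivity) hH.1 hH.2
    (fun x hx => by simpa using hx) one_pos (by norm_num)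
    (fun x hx y hy => by
      have := neg_le_of_abs_le (abs_real_inner_le_norm x y)
      rw [mem_sphere_zero_iff_norm.1 hx, mem_sphere_zero_iff_norm.1 hy] at this
      linarith)
    (fun x hx y hy => by
      obtain ⟨g, hg⟩ := exists_linearIsometryEquiv_of_norm_eq (v := x) (w := y)
        ((mem_sphere_zero_iff_norm.1 hx).trans (mem_sphere_zero_iff_norm.1 hy).symm)
      exact ⟨g, mem_symmetryGroup_sphere g, hg⟩)
    (EuclideanSpace.single 0 1)
    (fun x hx y hy => by
      obtain ⟨g, hg⟩ := exists_linearIsometryEquiv_of_norm_eq (v := x - y)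
        (w := ‖x - y‖ • EuclideanSpace.single (0 : Fin (d + 1)) (1 : ℝ))
        (by rw [norm_smul, he0, mul_one, norm_norm])
      exact ⟨g, mem_symmetryGroup_sphere g, hg⟩)
    ⟨EuclideanSpace.single 0 1, by simp, -EuclideanSpace.single 0 1, by simp, fun h => by
      have h2 := congrArg (fun v : EuclideanSpace ℝ (Fin (d + 1)) => v 0) h
      norm_num at h2⟩
    (TwoPointSpace.sphere d hd).theta
    (fun x y => by simp only [TwoPointSpace.theta, one_mul, add_zero]; rfl)
    (TwoPointSpace.sphere d hd).mu rfl (TwoPointSpace.sphere d hd).tau (fun x y => rfl)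

end Sphere

/-! ### Composition algebras and trace-one Hermitian idempotents. -/

section Projective

open Filter Topology

/-- The identities of a real composition algebra with unit and conjugation that do not involve
associativity. -/
class RealCompositionAlgebra (F : Type) [NormedAddCommGroup F] [InnerProductSpace ℝ F]
    [Mul F] [One F] [Star F] : Prop where
  add_mul' : ∀ x y z : F, (x + y) * z = x * z + y * z
  mul_add' : ∀ x y z : F, x * (y + z) = x * y + x * z
  smul_mul' : ∀ (r : ℝ) (x y : F), (r • x) * y = r • (x * y)
  mul_smul' : ∀ (r : ℝ) (x y : F), x * (r • y) = r • (x * y)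
  one_mul' : ∀ x : F, 1 * x = x
  mul_one' : ∀ x : F, x * 1 = x
  norm_mul' : ∀ x y : F, ‖x * y‖ = ‖x‖ * ‖y‖
  norm_one' : ‖(1 : F)‖ = 1
  star_mul' : ∀ x y : F, star (x * y) = star y * star x
  star_star' : ∀ x : F, star (star x) = x
  star_add' : ∀ x y : F, star (x + y) = star x + star y
  star_smul' : ∀ (r : ℝ) (x : F), star (r • x) = r • star x
  norm_star' : ∀ x : F, ‖star x‖ = ‖x‖
  mul_star_self' : ∀ x : F, x * star x = ‖x‖ ^ 2 • (1 : F)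

namespace RealCompositionAlgebra

variable {F : Type} [NormedAddCommGroup F] [InnerProductSpace ℝ F]
  [Mul F] [One F] [Star F] [RealCompositionAlgebra F]

lemma star_one' : star (1 : F) = 1 := by
  have h := star_mul' (star (1 : F)) 1
  rw [mul_one', star_star', mul_one'] at h
  exact h.symm

lemma star_mul_self' (x : F) : star x * x = ‖x‖ ^ 2 • (1 : F) := by
  have := mul_star_self' (star x)
  rwa [star_star', norm_star'] at this

variable (F) in
/-- Multiplication as a continuous bilinear map. -/
def mulL : F →L[ℝ] F →L[ℝ] F :=
  LinearMap.mkContinuous₂ (LinearMap.mk₂ ℝ (fun x y : F => x * y) add_mul' smul_mul' mul_add'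
    mul_smul') 1 fun x y => by simp [norm_mul']

lemma mulL_apply (x y : F) : mulL F x y = x * y := rfl

variable (F) in
/-- Conjugation as a linear isometric equivalence. -/
def starL : F ≃ₗᵢ[ℝ] F where
  toFun := star
  invFun := star
  map_add' := star_add'
  map_smul' := star_smul'
  left_inv := star_star'
  right_inv := star_star'
  norm_map' := norm_star'

lemma starL_apply (x : F) : starL F x = star x := rfl

lemma sum_mul' {ι : Type*} (s : Finset ι) (f : ι → F) (x : F) :
    (∑ i ∈ s, f i) * x = ∑ i ∈ s, f i * x := by
  simp_rw [← mulL_apply, map_sum, sum_apply]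

lemma mul_sum' {ι : Type*} (s : Finset ι) (f : ι → F) (x : F) :
    x * (∑ i ∈ s, f i) = ∑ i ∈ s, x * f i := by
  simp_rw [← mulL_apply, map_sum]

lemma star_sum' {ι : Type*} (s : Finset ι) (f : ι → F) :
    star (∑ i ∈ s, f i) = ∑ i ∈ s, star (f i) := by
  simp_rw [← starL_apply, map_sum]

lemma one_ne_zero' : (1 : F) ≠ 0 := fun h => by
  have := norm_one' (F := F)
  rw [h, norm_zero] at this
  exact zero_ne_one this

lemma smul_one_injective {r s : ℝ} (h : r • (1 : F) = s • (1 : F)) : r = s := by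
  have := sub_eq_zero.2 h
  rw [← sub_smul, smul_eq_zero] at this
  exact sub_eq_zero.1 (this.resolve_right one_ne_zero')

lemma norm_smul_one (r : ℝ) : ‖r • (1 : F)‖ = |r| := by
  rw [norm_smul, norm_one', mul_one, Real.norm_eq_abs]

end RealCompositionAlgebra

open RealCompositionAlgebra

variable {F : Type} [NormedAddCommGroup F] [InnerProductSpace ℝ F]
  [Mul F] [One F] [Star F] {n : ℕ}

lemma mem_projectiveSpace {A : MatrixSpace F n} :
    A ∈ projectiveSpace F n ↔ (∀ i j, star (A (j, i)) = A (i, j)) ∧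
      (∀ i j, ∑ k, A (i, k) * A (k, j) = A (i, j)) ∧ ∑ i, A (i, i) = 1 := by
  simp only [projectiveSpace, mem_ofPred_eq, Matrix.IsHermitian, ← Matrix.ext_iff,
    Matrix.conjTranspose_apply, Matrix.of_apply, Matrix.mul_apply, Matrix.trace, Matrix.diag_apply]

variable [RealCompositionAlgebra F]

/-- On the diagonal of A² = A the products are A_ik·conj(A_ik) = |A_ik|². Diagonal entries are thus
real and nonnegative, with no use of associativity. -/
lemma projectiveSpace_diag {A : MatrixSpace F n} (hA : A ∈ projectiveSpace F n)
    (i : Fin (n + 1)) : A (i, i) = (∑ k, ‖A (i, k)‖ ^ 2) • (1 : F) := by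
  obtain ⟨h1, h2, -⟩ := mem_projectiveSpace.1 hA
  rw [Finset.sum_smul, ← h2 i i]
  refine Finset.sum_congr rfl fun k _ => ?_
  rw [← h1 k i, mul_star_self']

lemma norm_projectiveSpace_diag {A : MatrixSpace F n} (hA : A ∈ projectiveSpace F n)
    (i : Fin (n + 1)) : ‖A (i, i)‖ = ∑ k, ‖A (i, k)‖ ^ 2 := by
  nth_rewrite 1 [projectiveSpace_diag hA]
  rw [norm_smul_one, abs_of_nonneg (by positivity)]

lemma projectiveSpace_diag' {A : MatrixSpace F n} (hA : A ∈ projectiveSpace F n)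
    (i : Fin (n + 1)) : A (i, i) = ‖A (i, i)‖ • (1 : F) := by
  rw [norm_projectiveSpace_diag hA, ← projectiveSpace_diag hA]

lemma sum_norm_projectiveSpace_diag {A : MatrixSpace F n} (hA : A ∈ projectiveSpace F n) :
    ∑ i, ‖A (i, i)‖ = 1 := by
  apply smul_one_injective (F := F)
  rw [Finset.sum_smul, one_smul]
  refine Eq.trans ?_ (mem_projectiveSpace.1 hA).2.2
  exact Finset.sum_congr rfl fun i _ => (projectiveSpace_diag' hA i).symm

/-- The sum of the squares of all entries is the sum of the diagonal entries, which is the trace. -/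
lemma norm_of_mem_projectiveSpace {A : MatrixSpace F n} (hA : A ∈ projectiveSpace F n) :
    ‖A‖ = 1 := by
  rw [← sq_eq_sq₀ (norm_nonneg _) zero_le_one, one_pow, PiLp.norm_sq_eq_of_L2,
    Fintype.sum_prod_type]
  simp_rw [← norm_projectiveSpace_diag hA]
  exact sum_norm_projectiveSpace_diag hA

lemma projectiveSpace_swap_norm {A : MatrixSpace F n} (hA : A ∈ projectiveSpace F n)
    (i j : Fin (n + 1)) : ‖A (i, j)‖ = ‖A (j, i)‖ := by
  rw [← (mem_projectiveSpace.1 hA).1 i j, norm_star']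

lemma isCompact_projectiveSpace [FiniteDimensional ℝ F] : IsCompact (projectiveSpace F n) := by
  refine Metric.isCompact_of_isClosed_isBounded ?_ ?_
  · have h : projectiveSpace F n = {A : MatrixSpace F n | (∀ i j, starL F (A (j, i)) = A (i, j)) ∧
      (∀ i j, ∑ k, mulL F (A (i, k)) (A (k, j)) = A (i, j)) ∧ ∑ i, A (i, i) = 1} := by
      ext A; exact mem_projectiveSpace
    rw [h]
    have hc : ∀ p, Continuous fun A : MatrixSpace F n => A p := fun p => by fun_prop
    refine IsClosed.and ?_ (IsClosed.and ?_ ?_)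
    · simp only [ofPred_forall]
      exact isClosed_iInter fun i => isClosed_iInter fun j =>
        isClosed_eq ((starL F).continuous.comp (hc _)) (hc _)
    · simp only [ofPred_forall]
      exact isClosed_iInter fun i => isClosed_iInter fun j =>
        isClosed_eq (continuous_finsetSum _ fun k _ =>
          (mulL F).isBoundedBilinearMap.continuous.comp ((hc _).prodMk (hc _))) (hc _)
    · exact isClosed_eq (continuous_finsetSum _ fun k _ => hc _) continuous_const
  · exact (Metric.isBounded_closedBall (x := 0) (r := 1)).subset fun A hA => by
      simpa using (norm_of_mem_projectiveSpace hA).le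

/-! ### Conjugation by real orthogonal matrices -/

/-- The map `A ↦ R A Rᵀ` for a real matrix `R`. -/
def realConj (F : Type) [NormedAddCommGroup F] [InnerProductSpace ℝ F]
    (R : Matrix (Fin (n + 1)) (Fin (n + 1)) ℝ) : MatrixSpace F n →ₗ[ℝ] MatrixSpace F n where
  toFun A := WithLp.toLp 2 fun p => ∑ k, ∑ l, (R p.1 k * R p.2 l) • A (k, l)
  map_add' A B := by
    ext p
    simp [smul_add, Finset.sum_add_distrib]
  map_smul' c A := by
    ext p
    simp [Finset.smul_sum, smul_comm c]

lemma realConj_apply {F : Type} [NormedAddCommGroup F] [InnerProductSpace ℝ F]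
    (R : Matrix (Fin (n + 1)) (Fin (n + 1)) ℝ) (A : MatrixSpace F n)
    (i j : Fin (n + 1)) : realConj F R A (i, j) = ∑ k, ∑ l, (R i k * R j l) • A (k, l) := rfl

lemma realConj_one {F : Type} [NormedAddCommGroup F] [InnerProductSpace ℝ F]
    (A : MatrixSpace F n) : realConj F 1 A = A := by
  ext ⟨i, j⟩
  simp [realConj_apply, Matrix.one_apply, ite_smul]

lemma realConj_realConj {F : Type} [NormedAddCommGroup F] [InnerProductSpace ℝ F]
    (R S : Matrix (Fin (n + 1)) (Fin (n + 1)) ℝ)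
    (A : MatrixSpace F n) : realConj F R (realConj F S A) = realConj F (R * S) A := by
  ext ⟨i, j⟩
  simp only [realConj_apply, Matrix.mul_apply, Finset.smul_sum, smul_smul, Finset.sum_mul_sum,
    Finset.sum_smul]
  calc _ = ∑ k, ∑ p, ∑ l, ∑ q, (R i k * R j l * (S k p * S l q)) • A (p, q) :=
        Finset.sum_congr rfl fun k _ => Finset.sum_comm
    _ = ∑ p, ∑ k, ∑ q, ∑ l, (R i k * R j l * (S k p * S l q)) • A (p, q) := by
        rw [Finset.sum_comm]
        exact Finset.sum_congr rfl fun p _ => Finset.sum_congr rfl fun k _ => Finset.sum_comm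
    _ = _ := by
        refine Finset.sum_congr rfl fun p _ => ?_
        rw [Finset.sum_comm]
        refine Finset.sum_congr rfl fun q _ => Finset.sum_congr rfl fun k _ =>
          Finset.sum_congr rfl fun l _ => ?_
        congr 1
        ring

lemma sum_norm_sq_orthogonal {F : Type} [NormedAddCommGroup F] [InnerProductSpace ℝ F]
    {ι : Type*} [Fintype ι] [DecidableEq ι] {R : Matrix ι ι ℝ}
    (hR : R.transpose * R = 1) (a : ι → F) :
    ∑ i, ‖∑ k, R i k • a k‖ ^ 2 = ∑ k, ‖a k‖ ^ 2 := by
  simp_rw [← real_inner_self_eq_norm_sq, sum_inner, inner_sum, inner_smul_left, inner_smul_right]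
  have h : ∀ k l, ∑ i, R i k * R i l = if k = l then 1 else 0 := fun k l => by
    have := congrFun (congrFun hR k) l
    simpa [Matrix.mul_apply, Matrix.one_apply] using this
  calc _ = ∑ k, ∑ l, (∑ i, R i k * R i l) * inner ℝ (a k) (a l) := by
        rw [Finset.sum_comm]
        refine Finset.sum_congr rfl fun k _ => ?_
        rw [Finset.sum_comm]
        refine Finset.sum_congr rfl fun l _ => ?_
        rw [Finset.sum_mul]
        refine Finset.sum_congr rfl fun i _ => ?_
        simp [mul_assoc]
    _ = _ := by simp [h]

lemma norm_realConj {F : Type} [NormedAddCommGroup F] [InnerProductSpace ℝ F]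
    {R : Matrix (Fin (n + 1)) (Fin (n + 1)) ℝ} (hR : R.transpose * R = 1)
    (A : MatrixSpace F n) : ‖realConj F R A‖ = ‖A‖ := by
  rw [← sq_eq_sq₀ (norm_nonneg _) (norm_nonneg _), PiLp.norm_sq_eq_of_L2, PiLp.norm_sq_eq_of_L2,
    Fintype.sum_prod_type, Fintype.sum_prod_type]
  simp_rw [realConj_apply, mul_smul, ← Finset.smul_sum]
  rw [Finset.sum_comm]
  simp_rw [sum_norm_sq_orthogonal hR]
  rw [Finset.sum_comm]
  simp_rw [sum_norm_sq_orthogonal hR]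

/-- The isometry `A ↦ R A Rᵀ` for a real orthogonal matrix `R`. -/
def realConjEquiv (F : Type) [NormedAddCommGroup F] [InnerProductSpace ℝ F]
    (R : Matrix (Fin (n + 1)) (Fin (n + 1)) ℝ) (hR : R.transpose * R = 1) :
    MatrixSpace F n ≃ₗᵢ[ℝ] MatrixSpace F n where
  toLinearEquiv := LinearEquiv.ofLinearMap (realConj F R) (realConj F R.transpose)
    (LinearMap.ext fun A => by
      simp only [LinearMap.comp_apply, realConj_realConj, LinearMap.id_apply,
        mul_eq_one_comm.1 hR, realConj_one])
    (LinearMap.ext fun A => by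
      simp only [LinearMap.comp_apply, realConj_realConj, LinearMap.id_apply, hR, realConj_one])
  norm_map' := norm_realConj hR

/-- Real scalars pass freely through products, so conjugation by a real orthogonal matrix respects
A² = A even over the octonions. -/
lemma realConj_mem {R : Matrix (Fin (n + 1)) (Fin (n + 1)) ℝ} (hR : R.transpose * R = 1)
    {A : MatrixSpace F n} (hA : A ∈ projectiveSpace F n) : realConj F R A ∈ projectiveSpace F n := by
  obtain ⟨h1, h2, h3⟩ := mem_projectiveSpace.1 hA
  have horth : ∀ k l, ∑ i, R i k * R i l = if k = l then 1 else 0 := fun k l => by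
    have := congrFun (congrFun hR k) l
    simpa [Matrix.mul_apply, Matrix.one_apply] using this
  refine mem_projectiveSpace.2 ⟨fun i j => ?_, fun i j => ?_, ?_⟩
  · simp_rw [realConj_apply, star_sum', star_smul', h1]
    rw [Finset.sum_comm]
    simp_rw [mul_comm]
  · simp_rw [realConj_apply, sum_mul', mul_sum', RealCompositionAlgebra.smul_mul', mul_smul', smul_smul]
    -- The middle index m is summed innermost so that RᵀR = 1 contracts l with p.
    calc _ = ∑ k, ∑ l, ∑ p, ∑ q, (R i k * R j q * ∑ m, R m l * R m p) • (A (k, l) * A (p, q)) := by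
          rw [Finset.sum_comm]
          refine Finset.sum_congr rfl fun k _ => ?_
          rw [Finset.sum_comm]
          refine Finset.sum_congr rfl fun l _ => ?_
          rw [Finset.sum_comm]
          refine Finset.sum_congr rfl fun p _ => ?_
          rw [Finset.sum_comm]
          refine Finset.sum_congr rfl fun q _ => ?_
          rw [Finset.mul_sum, Finset.sum_smul]
          refine Finset.sum_congr rfl fun m _ => ?_
          congr 1
          ring
      _ = ∑ k, ∑ l, ∑ q, (R i k * R j q) • (A (k, l) * A (l, q)) := by
          refine Finset.sum_congr rfl fun k _ => Finset.sum_congr rfl fun l _ => ?_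
          rw [Finset.sum_comm]
          refine Finset.sum_congr rfl fun q _ => ?_
          simp [horth, ite_smul]
      _ = _ := by
          refine Finset.sum_congr rfl fun k _ => ?_
          rw [Finset.sum_comm]
          refine Finset.sum_congr rfl fun q _ => ?_
          rw [← Finset.smul_sum, h2]
  · simp_rw [realConj_apply]
    rw [Finset.sum_comm, ← h3]
    refine Finset.sum_congr rfl fun k _ => ?_
    rw [Finset.sum_comm]
    simp_rw [← Finset.sum_smul, horth]
    simp [ite_smul]

lemma realConjEquiv_mem {R : Matrix (Fin (n + 1)) (Fin (n + 1)) ℝ} (hR : R.transpose * R = 1) :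
    realConjEquiv F R hR ∈ symmetryGroup (projectiveSpace F n) :=
  mem_symmetryGroup_of_maps (fun _ hx => realConj_mem hR hx) fun x hx =>
    realConj_mem (R := R.transpose) (by rw [Matrix.transpose_transpose]; exact mul_eq_one_comm.1 hR) hx

/-! ### Rank-one matrices of real vectors and their simultaneous diagonalization. -/

variable (F) in
/-- The matrix `v vᵀ` of a real vector `v`. -/
def realRankOne (v : Fin (n + 1) → ℝ) : MatrixSpace F n :=
  WithLp.toLp 2 fun p => (v p.1 * v p.2) • (1 : F)

lemma realRankOne_apply {F : Type} [NormedAddCommGroup F] [InnerProductSpace ℝ F] [One F]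
    (v : Fin (n + 1) → ℝ) (i j : Fin (n + 1)) :
    realRankOne F v (i, j) = (v i * v j) • (1 : F) := rfl

lemma realRankOne_mem {v : Fin (n + 1) → ℝ} (hv : ∑ i, v i ^ 2 = 1) :
    realRankOne F v ∈ projectiveSpace F n := by
  refine mem_projectiveSpace.2 ⟨fun i j => ?_, fun i j => ?_, ?_⟩
  · rw [realRankOne_apply, realRankOne_apply, star_smul', star_one', mul_comm]
  · simp_rw [realRankOne_apply, RealCompositionAlgebra.smul_mul', mul_smul', one_mul', smul_smul, ← Finset.sum_smul]
    congr 1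
    rw [← mul_one (v i * v j), ← hv, Finset.mul_sum]
    exact Finset.sum_congr rfl fun k _ => by ring
  · simp_rw [realRankOne_apply, ← Finset.sum_smul, ← sq, hv, one_smul]

lemma realConj_realRankOne {F : Type} [NormedAddCommGroup F] [InnerProductSpace ℝ F] [One F]
    (R : Matrix (Fin (n + 1)) (Fin (n + 1)) ℝ) (v : Fin (n + 1) → ℝ) :
    realConj F R (realRankOne F v) = realRankOne F (R.mulVec v) := by
  ext ⟨i, j⟩
  simp only [realConj_apply, realRankOne_apply, smul_smul, ← Finset.sum_smul, Matrix.mulVec,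
    dotProduct, Finset.sum_mul_sum]
  congr 1
  exact Finset.sum_congr rfl fun k _ => Finset.sum_congr rfl fun l _ => by ring

/-- The matrix whose rows are an orthonormal basis. -/
def basisMatrix (b : OrthonormalBasis (Fin (n + 1)) ℝ (EuclideanSpace ℝ (Fin (n + 1)))) :
    Matrix (Fin (n + 1)) (Fin (n + 1)) ℝ := Matrix.of fun i k => b i k

lemma basisMatrix_orthogonal
    (b : OrthonormalBasis (Fin (n + 1)) ℝ (EuclideanSpace ℝ (Fin (n + 1)))) :
    (basisMatrix b).transpose * basisMatrix b = 1 := by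
  rw [mul_eq_one_comm]
  ext i j
  have := orthonormal_iff_ite.1 b.orthonormal i j
  rw [PiLp.inner_apply] at this
  simpa [Matrix.mul_apply, basisMatrix, Matrix.one_apply, mul_comm] using this

lemma basisMatrix_mulVec
    (b : OrthonormalBasis (Fin (n + 1)) ℝ (EuclideanSpace ℝ (Fin (n + 1))))
    (v : EuclideanSpace ℝ (Fin (n + 1))) (i : Fin (n + 1)) :
    (basisMatrix b).mulVec v i = inner ℝ (b i) v := by
  simp [Matrix.mulVec, dotProduct, basisMatrix, PiLp.inner_apply, mul_comm]

lemma exists_orthonormalBasis_zero {v : EuclideanSpace ℝ (Fin (n + 1))} (hv : ‖v‖ = 1) :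
    ∃ b : OrthonormalBasis (Fin (n + 1)) ℝ (EuclideanSpace ℝ (Fin (n + 1))), b 0 = v := by
  obtain ⟨b, hb⟩ := Orthonormal.exists_orthonormalBasis_extension_of_card_eq (𝕜 := ℝ)
    (E := EuclideanSpace ℝ (Fin (n + 1))) (ι := Fin (n + 1)) (by simp) (v := fun _ => v) (s := {0})
    ⟨fun i => hv, fun i j hij => absurd (Subsingleton.elim i j) hij⟩
  exact ⟨b, hb 0 rfl⟩

lemma exists_orthonormalBasis_zero_one (hn : 1 ≤ n) {v w : EuclideanSpace ℝ (Fin (n + 1))}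
    (hv : ‖v‖ = 1) (hw : ‖w‖ = 1) (hvw : inner ℝ v w = 0) :
    ∃ b : OrthonormalBasis (Fin (n + 1)) ℝ (EuclideanSpace ℝ (Fin (n + 1))), b 0 = v ∧ b 1 = w := by
  have h01 : (1 : Fin (n + 1)) ≠ 0 := by
    intro h
    have := congrArg Fin.val h
    rw [Fin.val_one', Fin.val_zero, Nat.mod_eq_of_lt (by omega)] at this
    exact one_ne_zero this
  obtain ⟨b, hb⟩ := Orthonormal.exists_orthonormalBasis_extension_of_card_eq (𝕜 := ℝ)
    (E := EuclideanSpace ℝ (Fin (n + 1))) (ι := Fin (n + 1)) (by simp)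
    (v := fun i => if i = 0 then v else w) (s := {0, 1}) (by
      rw [orthonormal_iff_ite]
      rintro ⟨i, hi⟩ ⟨j, hj⟩
      rcases hi with rfl | rfl <;> rcases hj with rfl | rfl <;>
        simp [hv, hw, hvw, h01, h01.symm, real_inner_comm v w, Subtype.ext_iff])
  exact ⟨b, by simpa using hb 0 (by simp), by simpa [h01] using hb 1 (by simp)⟩

/-- The difference of two real rank one projections is diagonal with eigenvalues `s, -s, 0, …, 0`
in some orthonormal basis. -/
lemma exists_diagonalizing_basis (hn : 1 ≤ n) {u v : EuclideanSpace ℝ (Fin (n + 1))}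
    (hu : ‖u‖ = 1) (hv : ‖v‖ = 1) :
    ∃ (b : OrthonormalBasis (Fin (n + 1)) ℝ (EuclideanSpace ℝ (Fin (n + 1)))) (s : ℝ), 0 ≤ s ∧
      ∀ i j, inner ℝ (b i) u * inner ℝ (b j) u - inner ℝ (b i) v * inner ℝ (b j) v =
        s * ((Pi.single 0 1 : Fin (n + 1) → ℝ) i * (Pi.single 0 1 : Fin (n + 1) → ℝ) j -
          (Pi.single 1 1 : Fin (n + 1) → ℝ) i * (Pi.single 1 1 : Fin (n + 1) → ℝ) j) := by
  -- With f = u - v and g = u + v, one has uuᵀ - vvᵀ = ½(fgᵀ + gfᵀ) and f ⊥ g. Taking b₀ and b₁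
  -- along g/‖g‖ ± f/‖f‖ gives s(b₀b₀ᵀ - b₁b₁ᵀ) with s = ‖f‖‖g‖/2. If u = ±v the difference vanishes
  -- and any basis works.
  have hfg : inner ℝ (u - v) (u + v) = 0 := by
    rw [inner_sub_left, inner_add_right, inner_add_right, real_inner_self_eq_norm_sq,
      real_inner_self_eq_norm_sq, hu, hv, real_inner_comm]
    ring
  obtain ⟨b, hbf⟩ : ∃ b : OrthonormalBasis (Fin (n + 1)) ℝ (EuclideanSpace ℝ (Fin (n + 1))),
      ‖u - v‖ * ‖u + v‖ = 0 ∨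
        (u - v = (‖u - v‖ / Real.sqrt 2) • (b 0 - b 1) ∧
          u + v = (‖u + v‖ / Real.sqrt 2) • (b 0 + b 1)) := by
    by_cases h0 : ‖u - v‖ * ‖u + v‖ = 0
    · exact ⟨EuclideanSpace.basisFun _ _, Or.inl h0⟩
    · have hf : ‖u - v‖ ≠ 0 := left_ne_zero_of_mul h0
      have hg : ‖u + v‖ ≠ 0 := right_ne_zero_of_mul h0
      have hs : Real.sqrt 2 ≠ 0 := by positivity
      have hs2 : Real.sqrt 2 * Real.sqrt 2 = 2 := Real.mul_self_sqrt (by norm_num)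
      set p := (‖u - v‖)⁻¹ • (u - v) with hp
      set q := (‖u + v‖)⁻¹ • (u + v) with hq
      have hpp : inner ℝ p p = (1 : ℝ) := by
        rw [hp, inner_smul_left, inner_smul_right, real_inner_self_eq_norm_sq]
        simp; field_simp
      have hqq : inner ℝ q q = (1 : ℝ) := by
        rw [hq, inner_smul_left, inner_smul_right, real_inner_self_eq_norm_sq]
        simp; field_simp
      have hpq : inner ℝ p q = (0 : ℝ) := by
        rw [hp, hq, inner_smul_left, inner_smul_right, hfg]; simp
      have hqp : inner ℝ q p = (0 : ℝ) := by rw [real_inner_comm, hpq]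
      have hsq : (Real.sqrt 2)⁻¹ * ((Real.sqrt 2)⁻¹ * 2) = 1 := by
        field_simp; linarith
      have hnorm : ∀ x : EuclideanSpace ℝ (Fin (n + 1)), inner ℝ x x = (1 : ℝ) → ‖x‖ = 1 := by
        intro x hx
        rw [real_inner_self_eq_norm_sq] at hx
        exact (pow_eq_one_iff_of_nonneg (norm_nonneg x) two_ne_zero).1 hx
      obtain ⟨b, h1, h2⟩ := exists_orthonormalBasis_zero_one hn
        (v := (Real.sqrt 2)⁻¹ • (p + q)) (w := (Real.sqrt 2)⁻¹ • (q - p))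
        (hnorm _ (by
          rw [inner_smul_left, inner_smul_right, inner_add_left, inner_add_right, inner_add_right,
            hpp, hqq, hpq, hqp, ← hsq]
          simp; linarith))
        (hnorm _ (by
          rw [inner_smul_left, inner_smul_right, inner_sub_left, inner_sub_right, inner_sub_right,
            hpp, hqq, hpq, hqp, ← hsq]
          simp; linarith))
        (by
          rw [inner_smul_left, inner_smul_right, inner_add_left, inner_sub_right, inner_sub_right,
            hpp, hqq, hpq, hqp]
          simp)
      refine ⟨b, Or.inr ⟨?_, ?_⟩⟩
      · rw [h1, h2, ← smul_sub, show p + q - (q - p) = (2 : ℝ) • p by module, smul_smul, smul_smul, hp,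
          smul_smul]
        rw [show ‖u - v‖ / Real.sqrt 2 * (Real.sqrt 2)⁻¹ * 2 * ‖u - v‖⁻¹ = 1 by
          field_simp; linarith, one_smul]
      · rw [h1, h2, ← smul_add, show p + q + (q - p) = (2 : ℝ) • q by module, smul_smul, smul_smul, hq,
          smul_smul]
        rw [show ‖u + v‖ / Real.sqrt 2 * (Real.sqrt 2)⁻¹ * 2 * ‖u + v‖⁻¹ = 1 by
          field_simp; linarith, one_smul]
  refine ⟨b, ‖u - v‖ * ‖u + v‖ / 2, by positivity, fun i j => ?_⟩
  have hpol : inner ℝ (b i) u * inner ℝ (b j) u - inner ℝ (b i) v * inner ℝ (b j) v =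
      (inner ℝ (b i) (u - v) * inner ℝ (b j) (u + v) +
        inner ℝ (b i) (u + v) * inner ℝ (b j) (u - v)) / 2 := by
    simp only [inner_sub_right, inner_add_right]; ring
  rw [hpol]
  rcases hbf with h | ⟨hf, hg⟩
  · rw [h]
    rcases mul_eq_zero.1 h with h | h <;> rw [norm_eq_zero.1 h] <;> simp
  · have hb : ∀ i k, inner ℝ (b i) (b k) = (Pi.single k 1 : Fin (n + 1) → ℝ) i := fun i k => by
      rw [orthonormal_iff_ite.1 b.orthonormal i k]
      simp [Pi.single_apply]
    have hs2 : Real.sqrt 2 * Real.sqrt 2 = 2 := Real.mul_self_sqrt (by norm_num)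
    have hs : Real.sqrt 2 ≠ 0 := by positivity
    have hF : ∀ i, inner ℝ (b i) (u - v) = ‖u - v‖ / Real.sqrt 2 *
        ((Pi.single 0 1 : Fin (n + 1) → ℝ) i - (Pi.single 1 1 : Fin (n + 1) → ℝ) i) := fun i => by
      conv_lhs => rw [hf, inner_smul_right, inner_sub_right, hb, hb]
    have hG : ∀ i, inner ℝ (b i) (u + v) = ‖u + v‖ / Real.sqrt 2 *
        ((Pi.single 0 1 : Fin (n + 1) → ℝ) i + (Pi.single 1 1 : Fin (n + 1) → ℝ) i) := fun i => by
      conv_lhs => rw [hg, inner_smul_right, inner_add_right, hb, hb]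
    rw [hF, hF, hG, hG]
    generalize (Pi.single 0 1 : Fin (n + 1) → ℝ) i = a
    generalize (Pi.single 0 1 : Fin (n + 1) → ℝ) j = b
    generalize (Pi.single 1 1 : Fin (n + 1) → ℝ) i = c
    generalize (Pi.single 1 1 : Fin (n + 1) → ℝ) j = d
    field_simp
    rw [show Real.sqrt 2 ^ 2 = 2 by rw [sq, hs2]]
    ring

end Projective

/-! ### Two-point homogeneity and the invariance principle for projective spaces. -/

section ProjectiveMain

open Filter Topology RealCompositionAlgebra

variable {F : Type} [NormedAddCommGroup F] [InnerProductSpace ℝ F]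
  [Mul F] [One F] [Star F] {n : ℕ} [RealCompositionAlgebra F]

/-- The three facts on `projectiveSpace F n` whose proofs depend on `F`: its elements have rank
one, rank one matrices are idempotent up to scale, and any element is symmetric to a real matrix by
a symmetry that fixes the base point. -/
structure IsProjectiveGeometry (F : Type) [NormedAddCommGroup F] [InnerProductSpace ℝ F]
    [Mul F] [One F] [Star F] (n : ℕ) : Prop where
  mul_mul : ∀ A ∈ projectiveSpace F n, ∀ i k j, A (i, k) * A (k, j) = ‖A (k, k)‖ • A (i, j)
  vector_mul : ∀ w : Fin (n + 1) → F, (∃ r : ℝ, w 0 = r • (1 : F)) → ∀ i k j,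
    (w i * star (w k)) * (w k * star (w j)) = ‖w k‖ ^ 2 • (w i * star (w j))
  exists_real : ∀ A ∈ projectiveSpace F n, ∃ g ∈ symmetryGroup (projectiveSpace F n),
    g (realRankOne F (Pi.single 0 1)) = realRankOne F (Pi.single 0 1) ∧
    ∃ r : Fin (n + 1) → Fin (n + 1) → ℝ, ∀ i j, g A (i, j) = r i j • (1 : F)

namespace IsProjectiveGeometry

variable (h : IsProjectiveGeometry F n)

include h in
-- Trace one forces some r_kk > 0. The relation r_ik r_kj = r_kk r_ij then exhibits A as vvᵀ, with v
-- the k-th column divided by √r_kk.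
lemma exists_realRankOne {A : MatrixSpace F n} (hA : A ∈ projectiveSpace F n)
    {r : Fin (n + 1) → Fin (n + 1) → ℝ} (hr : ∀ i j, A (i, j) = r i j • (1 : F)) :
    ∃ v : EuclideanSpace ℝ (Fin (n + 1)), ‖v‖ = 1 ∧ A = realRankOne F v := by
  obtain ⟨h1, h2, h3⟩ := mem_projectiveSpace.1 hA
  have hdiag : ∀ k, ‖A (k, k)‖ = r k k := fun k =>
    smul_one_injective ((projectiveSpace_diag' hA k).symm.trans (hr k k))
  have htr : ∑ k, r k k = 1 := by
    simp_rw [← hdiag]; exact sum_norm_projectiveSpace_diag hA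
  have hsymm : ∀ i j, r i j = r j i := fun i j => by
    have := h1 i j
    rw [hr, hr, star_smul', star_one'] at this
    exact (smul_one_injective this).symm
  have hmul : ∀ i k j, r i k * r k j = r k k * r i j := fun i k j => by
    have := h.mul_mul A hA i k j
    rw [hdiag, hr, hr, hr, RealCompositionAlgebra.smul_mul', one_mul', smul_smul, smul_smul] at this
    exact smul_one_injective this
  obtain ⟨k, -, hk⟩ := Finset.exists_ne_zero_of_sum_ne_zero (htr.trans_ne one_ne_zero)
  have hk0 : 0 < r k k := lt_of_le_of_ne (hdiag k ▸ norm_nonneg _) hk.symm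
  have hv : ∀ i j, r i k / Real.sqrt (r k k) * (r j k / Real.sqrt (r k k)) = r i j := fun i j => by
    rw [div_mul_div_comm, Real.mul_self_sqrt hk0.le, hsymm j k, hmul]
    field_simp
  refine ⟨WithLp.toLp 2 fun i => r i k / Real.sqrt (r k k), ?_, ?_⟩
  · rw [EuclideanSpace.norm_eq, Real.sqrt_eq_one]
    simp_rw [Real.norm_eq_abs, sq_abs, sq, hv, htr]
  · ext ⟨i, j⟩
    rw [realRankOne_apply, hv, hr]

include h in
-- Make A real and rotate it to the base point; then make B real by a symmetry fixing the base
-- point, so that A stays in place. Questions about pairs thereby reduce to real projective space.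
lemma exists_symmetry_pair {A B : MatrixSpace F n} (hA : A ∈ projectiveSpace F n)
    (hB : B ∈ projectiveSpace F n) : ∃ g ∈ symmetryGroup (projectiveSpace F n),
    g A = realRankOne F (Pi.single 0 1) ∧
      ∃ v : EuclideanSpace ℝ (Fin (n + 1)), ‖v‖ = 1 ∧ g B = realRankOne F v := by
  obtain ⟨g₁, hg₁, -, r, hr⟩ := h.exists_real A hA
  obtain ⟨u, hu, hAu⟩ := h.exists_realRankOne ((hg₁ A).2 hA) hr
  obtain ⟨b, hb⟩ := exists_orthonormalBasis_zero hu
  set g₂ := realConjEquiv F (basisMatrix b) (basisMatrix_orthogonal b) with hg₂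
  have hg₂m : g₂ ∈ symmetryGroup (projectiveSpace F n) := realConjEquiv_mem _
  have h2 : g₂ (g₁ A) = realRankOne F (Pi.single 0 1) := by
    rw [hAu]
    refine (realConj_realRankOne _ _).trans ?_
    congr 1
    ext i
    rw [basisMatrix_mulVec, ← hb, orthonormal_iff_ite.1 b.orthonormal i 0]
    simp [Pi.single_apply]
  obtain ⟨g₃, hg₃, hg₃0, r', hr'⟩ := h.exists_real (g₂ (g₁ B)) ((hg₂m _).2 ((hg₁ B).2 hB))
  obtain ⟨v, hv, hBv⟩ := h.exists_realRankOne ((hg₃ _).2 ((hg₂m _).2 ((hg₁ B).2 hB))) hr'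
  refine ⟨g₃ * (g₂ * g₁), mul_mem hg₃ (mul_mem hg₂m hg₁), ?_, v, hv, hBv⟩
  change g₃ (g₂ (g₁ A)) = _
  rw [h2, hg₃0]

include h in
lemma exists_symmetry {A B : MatrixSpace F n} (hA : A ∈ projectiveSpace F n)
    (hB : B ∈ projectiveSpace F n) : ∃ g ∈ symmetryGroup (projectiveSpace F n), g A = B := by
  obtain ⟨g, hg, hgA, -⟩ := h.exists_symmetry_pair hA hA
  obtain ⟨g', hg', hgB, -⟩ := h.exists_symmetry_pair hB hB
  refine ⟨g'⁻¹ * g, mul_mem (inv_mem hg') hg, ?_⟩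
  change g'.symm (g A) = B
  rw [hgA, ← hgB, g'.symm_apply_apply]

include h in
-- After the reduction to real vectors the inner product is v₀². Nonnegativity is what keeps cos θ =
-- 2⟨A, B⟩ - 1 at least -1.
lemma inner_nonneg {A B : MatrixSpace F n} (hA : A ∈ projectiveSpace F n)
    (hB : B ∈ projectiveSpace F n) : 0 ≤ inner ℝ A B := by
  obtain ⟨g, hg, hgA, v, -, hgB⟩ := h.exists_symmetry_pair hA hB
  rw [← g.inner_map_map, hgA, hgB, PiLp.inner_apply, Fintype.sum_prod_type]
  refine Finset.sum_nonneg fun i _ => Finset.sum_nonneg fun j _ => ?_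
  rw [realRankOne_apply, realRankOne_apply, inner_smul_left, inner_smul_right,
    real_inner_self_eq_norm_sq, RealCompositionAlgebra.norm_one']
  by_cases hi : i = 0
  · by_cases hj : j = 0
    · simp [hi, hj, mul_self_nonneg]
    · simp [hj]
  · simp [hi]

/-- The normalized difference of two orthogonal points. -/
def chord (F : Type) [NormedAddCommGroup F] [InnerProductSpace ℝ F] [One F] (n : ℕ) :
    MatrixSpace F n :=
  (‖realRankOne F (n := n) (Pi.single 0 1) - realRankOne F (Pi.single 1 1)‖)⁻¹ •
    (realRankOne F (Pi.single 0 1) - realRankOne F (Pi.single 1 1))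

lemma realRankOne_zero_ne_one (hn : 1 ≤ n) :
    realRankOne F (n := n) (Pi.single 0 1) ≠ realRankOne F (Pi.single 1 1) := by
  intro h
  have h01 : (0 : Fin (n + 1)) ≠ 1 := by
    intro h
    have := congrArg Fin.val h
    rw [Fin.val_one', Fin.val_zero, Nat.mod_eq_of_lt (by omega)] at this
    exact zero_ne_one this
  have h2 := congrArg (fun A : MatrixSpace F n => A (0, 0)) h
  simp only [realRankOne_apply, Pi.single_eq_same, Pi.single_eq_of_ne h01, mul_one, mul_zero] at h2
  exact one_ne_zero (smul_one_injective h2)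

include h in
-- Reduce the pair to real projectors and diagonalize their difference to s(E₀ - E₁); since
-- symmetries are isometries, s is determined by ‖A - B‖.
lemma exists_symmetry_chord (hn : 1 ≤ n) {A B : MatrixSpace F n} (hA : A ∈ projectiveSpace F n)
    (hB : B ∈ projectiveSpace F n) : ∃ g ∈ symmetryGroup (projectiveSpace F n),
    g (A - B) = ‖A - B‖ • chord F n := by
  obtain ⟨g, hg, hgA, v, hv, hgB⟩ := h.exists_symmetry_pair hA hB
  obtain ⟨b, s, hs, hb⟩ := exists_diagonalizing_basis hn
    (u := EuclideanSpace.single (0 : Fin (n + 1)) (1 : ℝ)) (v := v) (by simp) hv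
  set g₂ := realConjEquiv F (basisMatrix b) (basisMatrix_orthogonal b) with hg₂
  have key : g₂ (g (A - B)) = s •
      (realRankOne F (Pi.single 0 1) - realRankOne F (Pi.single 1 1)) := by
    rw [map_sub, map_sub, hgA, hgB]
    change realConj F (basisMatrix b) (realRankOne F (EuclideanSpace.single (0 : Fin (n + 1)) (1 : ℝ)))
      - realConj F (basisMatrix b) (realRankOne F v) = _
    rw [realConj_realRankOne, realConj_realRankOne]
    ext ⟨i, j⟩
    rw [PiLp.sub_apply, PiLp.smul_apply, PiLp.sub_apply]
    simp only [realRankOne_apply]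
    rw [← sub_smul, ← sub_smul, smul_smul, basisMatrix_mulVec, basisMatrix_mulVec,
      basisMatrix_mulVec, basisMatrix_mulVec, hb]
  refine ⟨g₂ * g, mul_mem (realConjEquiv_mem _) hg, ?_⟩
  change g₂ (g (A - B)) = _
  have hnorm : ‖A - B‖ = s *
      ‖realRankOne F (n := n) (Pi.single 0 1) - realRankOne F (Pi.single 1 1)‖ := by
    rw [← g.norm_map, ← g₂.norm_map, key, norm_smul, Real.norm_of_nonneg hs]
  have hne : ‖realRankOne F (n := n) (Pi.single 0 1) - realRankOne F (Pi.single 1 1)‖ ≠ 0 :=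
    norm_ne_zero_iff.2 (sub_ne_zero.2 (realRankOne_zero_ne_one hn))
  rw [key, hnorm, chord, smul_smul, mul_assoc, mul_inv_cancel₀ hne, mul_one]

/-! ### A chart at the base point -/

/-- The entries of the zeroth column of a matrix, without the diagonal one. -/
def columnProjection (F : Type) [NormedAddCommGroup F] [InnerProductSpace ℝ F] (n : ℕ)
    [FiniteDimensional ℝ F] : MatrixSpace F n →L[ℝ] PiLp 2 fun _ : Fin n => F :=
  LinearMap.toContinuousLinearMap
    { toFun := fun A => WithLp.toLp 2 fun i => A (i.succ, 0)
      map_add' := fun _ _ => rfl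
      map_smul' := fun _ _ => rfl }

lemma columnProjection_apply {F : Type} [NormedAddCommGroup F] [InnerProductSpace ℝ F]
    [FiniteDimensional ℝ F] (A : MatrixSpace F n) (i : Fin n) :
    columnProjection F n A i = A (i.succ, 0) := rfl

/-- The zeroth diagonal entry as a function of the rest of the column. -/
def chartHead (w : PiLp 2 fun _ : Fin n => F) : ℝ := (1 + Real.sqrt (1 - 4 * ‖w‖ ^ 2)) / 2

/-- The zeroth column. -/
def chartColumn (w : PiLp 2 fun _ : Fin n => F) : Fin (n + 1) → F :=
  Fin.cons (chartHead w • (1 : F)) w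

/-- The rank one projection with given zeroth column. -/
def projectiveChart (w : PiLp 2 fun _ : Fin n => F) : MatrixSpace F n :=
  WithLp.toLp 2 fun p => (chartHead w)⁻¹ • (chartColumn w p.1 * star (chartColumn w p.2))

lemma projectiveChart_apply {F : Type} [NormedAddCommGroup F] [InnerProductSpace ℝ F]
    [Mul F] [One F] [Star F] (w : PiLp 2 fun _ : Fin n => F) (i j : Fin (n + 1)) :
    projectiveChart w (i, j) = (chartHead w)⁻¹ • (chartColumn w i * star (chartColumn w j)) := rfl

lemma chartHead_pos {F : Type} [NormedAddCommGroup F] (w : PiLp 2 fun _ : Fin n => F) : 0 < chartHead w := by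
  unfold chartHead; positivity

/-- The head t is the larger root of t² + ‖w‖² = t, the diagonal equation that idempotency imposes
on the zeroth column. -/
lemma sum_norm_chartColumn {w : PiLp 2 fun _ : Fin n => F} (hw : 4 * ‖w‖ ^ 2 ≤ 1) :
    ∑ i, ‖chartColumn w i‖ ^ 2 = chartHead w := by
  rw [Fin.sum_univ_succ]
  simp only [chartColumn, Fin.cons_zero, Fin.cons_succ]
  rw [norm_smul_one, sq_abs, ← PiLp.norm_sq_eq_of_L2]
  have := Real.sq_sqrt (sub_nonneg.2 hw)
  unfold chartHead
  nlinarith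

include h in
lemma projectiveChart_mem {w : PiLp 2 fun _ : Fin n => F} (hw : 4 * ‖w‖ ^ 2 ≤ 1) :
    projectiveChart w ∈ projectiveSpace F n := by
  refine mem_projectiveSpace.2 ⟨fun i j => ?_, fun i j => ?_, ?_⟩
  · rw [projectiveChart_apply, projectiveChart_apply, star_smul', RealCompositionAlgebra.star_mul', star_star']
  · simp_rw [projectiveChart_apply, RealCompositionAlgebra.smul_mul', mul_smul',
      h.vector_mul (chartColumn w) ⟨chartHead w, rfl⟩, smul_smul, ← Finset.sum_smul,
      ← Finset.mul_sum, sum_norm_chartColumn hw]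
    rw [inv_mul_cancel₀ (chartHead_pos w).ne', mul_one]
  · simp_rw [projectiveChart_apply, mul_star_self', ← Finset.smul_sum, ← Finset.sum_smul,
      sum_norm_chartColumn hw, smul_smul, inv_mul_cancel₀ (chartHead_pos w).ne', one_smul]

lemma columnProjection_projectiveChart [FiniteDimensional ℝ F] (w : PiLp 2 fun _ : Fin n => F) :
    columnProjection F n (projectiveChart w) = w := by
  ext i
  rw [columnProjection_apply, projectiveChart_apply]
  simp only [chartColumn, Fin.cons_zero, Fin.cons_succ]
  rw [star_smul', star_one', mul_smul', mul_one', smul_smul,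
    inv_mul_cancel₀ (chartHead_pos w).ne', one_smul]

include h in
-- The condition A₀₀ > 1/2 selects the larger root, so the head is A₀₀; the relation A_i0 A_0j = A₀₀
-- A_ij then recovers A from its zeroth column.
lemma projectiveChart_columnProjection [FiniteDimensional ℝ F] {A : MatrixSpace F n}
    (hA : A ∈ projectiveSpace F n) (hA0 : 1 / 2 < ‖A (0, 0)‖) :
    projectiveChart (columnProjection F n A) = A := by
  have h1 := norm_projectiveSpace_diag hA 0
  rw [Fin.sum_univ_succ] at h1
  simp_rw [projectiveSpace_swap_norm hA 0] at h1
  have h2 : ∑ i : Fin n, ‖A (i.succ, 0)‖ ^ 2 = ‖columnProjection F n A‖ ^ 2 := by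
    rw [PiLp.norm_sq_eq_of_L2]; rfl
  rw [h2] at h1
  have hhead : chartHead (columnProjection F n A) = ‖A (0, 0)‖ := by
    unfold chartHead
    rw [show 1 - 4 * ‖columnProjection F n A‖ ^ 2 = (2 * ‖A (0, 0)‖ - 1) ^ 2 by linarith,
      Real.sqrt_sq (by linarith)]
    ring
  have hcol : ∀ i, chartColumn (columnProjection F n A) i = A (i, 0) := by
    refine Fin.cases ?_ fun i => ?_
    · simp only [chartColumn, Fin.cons_zero]
      rw [hhead, ← projectiveSpace_diag' hA]
    · simp only [chartColumn, Fin.cons_succ]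
      rfl
  ext ⟨i, j⟩
  rw [projectiveChart_apply, hcol, hcol, (mem_projectiveSpace.1 hA).1, h.mul_mul A hA, hhead,
    smul_smul, inv_mul_cancel₀ (by linarith), one_smul]

lemma contDiffAt_projectiveChart [FiniteDimensional ℝ F] :
    ContDiffAt ℝ 1 (projectiveChart : (PiLp 2 fun _ : Fin n => F) → MatrixSpace F n) 0 := by
  have hhead : ContDiffAt ℝ 1 (chartHead : (PiLp 2 fun _ : Fin n => F) → ℝ) 0 := by
    unfold chartHead
    refine ContDiffAt.div_const (contDiffAt_const.add (ContDiffAt.sqrt ?_ (by simp))) _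
    exact contDiffAt_const.sub (contDiffAt_const.mul (contDiff_norm_sq ℝ).contDiffAt)
  have hcol : ∀ i, ContDiffAt ℝ 1 (fun w : PiLp 2 fun _ : Fin n => F => chartColumn w i) 0 := by
    refine Fin.cases ?_ fun i => ?_
    · simp only [chartColumn, Fin.cons_zero]
      exact hhead.smul contDiffAt_const
    · simp only [chartColumn, Fin.cons_succ]
      exact ((contDiff_piLp 2).1 contDiff_id i).contDiffAt
  unfold projectiveChart
  refine (PiLp.contDiff_toLp (p := 2)).contDiffAt.comp _ ?_
  refine contDiffAt_pi.2 fun p => ?_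
  refine (hhead.inv (chartHead_pos _).ne').smul ?_
  exact (mulL F).isBoundedBilinearMap.contDiff.contDiffAt.comp (0 : PiLp 2 fun _ : Fin n => F)
    ((hcol p.1).prodMk ((starL F).contDiff.contDiffAt.comp _ (hcol p.2)))

include h in
lemma hausdorffMeasure_projectiveSpace [FiniteDimensional ℝ F] [MeasurableSpace (MatrixSpace F n)]
    [BorelSpace (MatrixSpace F n)] :
    μH[(n * Module.finrank ℝ F : ℕ)] (projectiveSpace F n) ≠ 0 ∧
      μH[(n * Module.finrank ℝ F : ℕ)] (projectiveSpace F n) ≠ ⊤ := by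
  have hE : realRankOne F (n := n) (Pi.single 0 1) ∈ projectiveSpace F n :=
    realRankOne_mem (by simp [Pi.single_apply])
  have hp0 : columnProjection F n (realRankOne F (Pi.single 0 1)) = 0 := by
    ext i
    rw [columnProjection_apply, realRankOne_apply]
    simp [Fin.succ_ne_zero]
  have h1 := hausdorffMeasure_pos_and_lt_top (x₀ := realRankOne F (n := n) (Pi.single 0 1))
    isCompact_projectiveSpace (fun x hx => h.exists_symmetry hx hE) (columnProjection F n)
    projectiveChart (by rw [hp0]; exact contDiffAt_projectiveChart) ?_ ?_
  · have hfr : Module.finrank ℝ (PiLp 2 fun _ : Fin n => F) = n * Module.finrank ℝ F := by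
      rw [(WithLp.linearEquiv 2 ℝ (Fin n → F)).finrank_eq, Module.finrank_pi_fintype]
      simp
    rwa [hfr] at h1
  · rw [hp0]
    -- Radius 1/2 is where 1 - 4‖w‖² stays nonnegative.
    filter_upwards [Metric.ball_mem_nhds (0 : PiLp 2 fun _ : Fin n => F) (ε := 1 / 2)
      (by norm_num)] with w hw
    rw [mem_ball_zero_iff] at hw
    exact ⟨h.projectiveChart_mem (by nlinarith [norm_nonneg w]), columnProjection_projectiveChart w⟩
  · have h2 : ∀ᶠ A : MatrixSpace F n in
        𝓝[projectiveSpace F n] (realRankOne F (Pi.single 0 1)), 1 / 2 < ‖A (0, 0)‖ := by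
      refine nhdsWithin_le_nhds ?_
      have hc : Continuous fun A : MatrixSpace F n => ‖A (0, 0)‖ := by fun_prop
      refine hc.continuousAt.eventually (lt_mem_nhds ?_)
      simp only
      rw [realRankOne_apply, norm_smul_one]
      norm_num
    filter_upwards [h2, self_mem_nhdsWithin] with A hA hAP
    exact h.projectiveChart_columnProjection hAP hA

/-- The duplication formula turns cos²(θ/2) = t into cos θ = 2t - 1, that is κ = 2 and b = -1. -/
lemma two_mul_arccos_sqrt {t : ℝ} (h0 : 0 ≤ t) (h1 : t ≤ 1) :
    2 * Real.arccos (Real.sqrt t) = Real.arccos (2 * t + -1) := by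
  have hs : Real.sqrt t ≤ 1 := Real.sqrt_le_one.2 h1
  have hle : Real.arccos (Real.sqrt t) ≤ Real.pi / 2 :=
    Real.arccos_le_pi_div_two.2 (Real.sqrt_nonneg t)
  rw [← Real.arccos_cos (x := 2 * Real.arccos (Real.sqrt t))
    (by linarith [Real.arccos_nonneg (Real.sqrt t)]) (by linarith), Real.cos_two_mul,
    Real.cos_arccos (by linarith [Real.sqrt_nonneg t]) hs, Real.sq_sqrt h0]
  rfl

include h in
theorem stolarsky [FiniteDimensional ℝ F] (hn : 1 ≤ n) [MeasurableSpace (MatrixSpace F n)]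
    [BorelSpace (MatrixSpace F n)] (d : ℕ) (hd : d = n * Module.finrank ℝ F)
    (θ : projectiveSpace F n → projectiveSpace F n → ℝ)
    (hθ : ∀ x y, θ x y = 2 * Real.arccos (Real.sqrt (inner ℝ (x : MatrixSpace F n) y)))
    (μ : Measure (projectiveSpace F n)) (hμ : μ = normalizedHausdorff (projectiveSpace F n) (d : ℝ))
    (τ : projectiveSpace F n → projectiveSpace F n → ℝ) (hτ : ∀ x y, τ x y = Real.sin (θ x y / 2)) :
    averageDistance μ τ / averageDistance μ (symmDiffMetric θ μ Real.sin) =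
      diameter τ / diameter (symmDiffMetric θ μ Real.sin) ∧
    ∀ N : ℕ, (∀ D : Fin N → projectiveSpace F n,
      averageDistance μ τ / averageDistance μ (symmDiffMetric θ μ Real.sin) *
        quadraticDiscrepancy θ μ Real.sin D + distanceSum τ D
          = averageDistance μ τ * (N : ℝ) ^ 2) ∧
      averageDistance μ τ / averageDistance μ (symmDiffMetric θ μ Real.sin) *
        extremalDiscrepancy θ μ Real.sin N + extremalDistanceSum τ N
        = averageDistance μ τ * (N : ℝ) ^ 2 := by
  subst hd
  have hle : ∀ x y : projectiveSpace F n, inner ℝ (x : MatrixSpace F n) y ≤ (1 : ℝ) := fun x y => by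
    have := real_inner_le_norm (x : MatrixSpace F n) y
    rwa [norm_of_mem_projectiveSpace x.2, norm_of_mem_projectiveSpace y.2, mul_one] at this
  refine stolarsky_of_embedded isCompact_projectiveSpace (κ := 2) (b := -1)
    (by positivity) h.hausdorffMeasure_projectiveSpace.1
    h.hausdorffMeasure_projectiveSpace.2 (fun x hx => norm_of_mem_projectiveSpace hx) two_pos
    (by norm_num) (fun x hx y hy => by linarith [h.inner_nonneg hx hy])
    (fun x hx y hy => h.exists_symmetry hx hy) (chord F n)
    (fun x hx y hy => h.exists_symmetry_chord hn hx hy)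
    ⟨_, realRankOne_mem (by simp [Pi.single_apply]), _, realRankOne_mem (by simp [Pi.single_apply]),
      realRankOne_zero_ne_one hn⟩ θ (fun x y => ?_) μ hμ τ hτ
  rw [hθ, two_mul_arccos_sqrt (h.inner_nonneg x.2 y.2) (hle x y)]

end IsProjectiveGeometry

end ProjectiveMain

/-! ### Real, complex and quaternionic projective spaces. -/

section Associative

open RealCompositionAlgebra

namespace RealCompositionAlgebra

variable {F : Type} [NormedAddCommGroup F] [InnerProductSpace ℝ F]
  [Mul F] [One F] [Star F] [RealCompositionAlgebra F]

lemma sub_mul' (x y z : F) : (x - y) * z = x * z - y * z := by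
  simp_rw [← mulL_apply, map_sub, sub_apply]

lemma mul_sub' (x y z : F) : x * (y - z) = x * y - x * z := by
  simp_rw [← mulL_apply, map_sub]

lemma zero_mul' (x : F) : 0 * x = 0 := by
  simp_rw [← mulL_apply, map_zero, zero_apply]

lemma mul_zero' (x : F) : x * 0 = 0 := by
  simp_rw [← mulL_apply, map_zero]

lemma star_sub' (x y : F) : star (x - y) = star x - star y := by
  simp_rw [← starL_apply, map_sub]

lemma star_zero' : star (0 : F) = 0 := by
  simp_rw [← starL_apply, map_zero]

end RealCompositionAlgebra

variable {F : Type} [NormedAddCommGroup F] [InnerProductSpace ℝ F]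
  [Mul F] [One F] [Star F] {n : ℕ} [RealCompositionAlgebra F]

lemma projectiveSpace_entry_eq_zero {A : MatrixSpace F n} (hA : A ∈ projectiveSpace F n)
    {k : Fin (n + 1)} (hk : ‖A (k, k)‖ = 0) (i : Fin (n + 1)) : A (i, k) = 0 := by
  rw [norm_projectiveSpace_diag hA, Finset.sum_eq_zero_iff_of_nonneg fun _ _ => by positivity] at hk
  have := hk i (Finset.mem_univ i)
  rw [projectiveSpace_swap_norm hA] at this
  simpa using this

/-- If A_kk ≠ 0, subtract from A the projector onto the line of its k-th column. The remainder z is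
again a Hermitian idempotent, of trace 1 - 1 = 0; its trace is also Σ|z_ij|², so z = 0. If A_kk = 0,
the k-th column vanishes. -/
lemma projectiveSpace_mul_mul_of_assoc (hassoc : ∀ x y z : F, x * y * z = x * (y * z))
    {A : MatrixSpace F n} (hA : A ∈ projectiveSpace F n) (i k j : Fin (n + 1)) :
    A (i, k) * A (k, j) = ‖A (k, k)‖ • A (i, j) := by
  obtain ⟨h1, h2, h3⟩ := mem_projectiveSpace.1 hA
  by_cases hk : ‖A (k, k)‖ = 0
  · rw [hk, projectiveSpace_entry_eq_zero hA hk, zero_mul', zero_smul]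
  set t := ‖A (k, k)‖ with ht
  have hkk : A (k, k) = t • (1 : F) := projectiveSpace_diag' hA k
  set z : Fin (n + 1) → Fin (n + 1) → F := fun i j => A (i, j) - t⁻¹ • (A (i, k) * A (k, j)) with hz
  have hzs : ∀ i j, star (z i j) = z j i := fun i j => by
    simp only [hz, star_sub', star_smul', RealCompositionAlgebra.star_mul', h1]
  have hzz : ∀ i, z i i = ∑ j, z i j * z j i := fun i => by
    have e : ∀ j, z i j * z j i = A (i, j) * A (j, i) - t⁻¹ • ((A (i, j) * A (j, k)) * A (k, i)) -
        t⁻¹ • (A (i, k) * (A (k, j) * A (j, i))) +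
        (t⁻¹ * t⁻¹) • (A (i, k) * ((A (k, j) * A (j, k)) * A (k, i))) := fun j => by
      simp only [hz, sub_mul', mul_sub', RealCompositionAlgebra.smul_mul', mul_smul', hassoc]
      module
    simp_rw [e, Finset.sum_add_distrib, Finset.sum_sub_distrib, ← Finset.smul_sum, ← mul_sum',
      ← sum_mul', h2, hkk, RealCompositionAlgebra.smul_mul', mul_smul', one_mul', smul_smul, hz]
    rw [inv_mul_cancel_right₀ hk]
    abel
  have hsum : ∑ i, ∑ j, ‖z i j‖ ^ 2 = 0 := by
    apply smul_one_injective (F := F)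
    rw [Finset.sum_smul, zero_smul]
    have e : ∀ i, (∑ j, ‖z i j‖ ^ 2) • (1 : F) = z i i := fun i => by
      rw [Finset.sum_smul, hzz]
      exact Finset.sum_congr rfl fun j _ => by rw [← hzs i j, mul_star_self']
    simp_rw [e, hz, Finset.sum_sub_distrib, h3]
    have e2 : ∀ i, A (i, k) * A (k, i) = ‖A (k, i)‖ ^ 2 • (1 : F) := fun i => by
      rw [← h1 i k, star_mul_self']
    simp_rw [e2, ← Finset.smul_sum, ← Finset.sum_smul, ← norm_projectiveSpace_diag hA, smul_smul]
    rw [inv_mul_cancel₀ hk, one_smul, sub_self]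
  have hz0 : z i j = 0 := by
    rw [Finset.sum_eq_zero_iff_of_nonneg fun _ _ => by positivity] at hsum
    have := hsum i (Finset.mem_univ i)
    rw [Finset.sum_eq_zero_iff_of_nonneg fun _ _ => by positivity] at this
    simpa using this j (Finset.mem_univ j)
  have := sub_eq_zero.1 hz0
  rw [this, smul_smul, mul_inv_cancel₀ hk, one_smul]

lemma exists_phase (x : F) : ∃ u : F, ‖u‖ = 1 ∧ u * x = ‖x‖ • (1 : F) := by
  by_cases hx : x = 0
  · exact ⟨1, RealCompositionAlgebra.norm_one', by rw [hx, mul_zero', norm_zero, zero_smul]⟩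
  · have hx' : ‖x‖ ≠ 0 := norm_ne_zero_iff.2 hx
    refine ⟨‖x‖⁻¹ • star x, ?_, ?_⟩
    · rw [norm_smul, norm_star', norm_inv, norm_norm, inv_mul_cancel₀ hx']
    · rw [RealCompositionAlgebra.smul_mul', star_mul_self', smul_smul, sq, inv_mul_cancel_left₀ hx']

lemma star_mul_self_of_norm_eq_one {u : F} (hu : ‖u‖ = 1) : star u * u = 1 := by
  rw [star_mul_self', hu, one_pow, one_smul]

lemma mul_star_self_of_norm_eq_one {u : F} (hu : ‖u‖ = 1) : u * star u = 1 := by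
  rw [mul_star_self', hu, one_pow, one_smul]

/-- The isometry `x ↦ u x v̄` for `u`, `v` of norm one. -/
def twoSidedMul (hassoc : ∀ x y z : F, x * y * z = x * (y * z)) {u v : F} (hu : ‖u‖ = 1)
    (hv : ‖v‖ = 1) : F ≃ₗᵢ[ℝ] F where
  toFun x := u * x * star v
  invFun x := star u * x * v
  map_add' x y := by rw [mul_add', add_mul']
  map_smul' r x := by rw [mul_smul', RealCompositionAlgebra.smul_mul']; rfl
  left_inv x := by
    change star u * (u * x * star v) * v = x
    rw [← hassoc (star u), ← hassoc (star u), star_mul_self_of_norm_eq_one hu, one_mul', hassoc,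
      star_mul_self_of_norm_eq_one hv, mul_one']
  right_inv x := by
    change u * (star u * x * v) * star v = x
    rw [← hassoc u, ← hassoc u, mul_star_self_of_norm_eq_one hu, one_mul', hassoc,
      mul_star_self_of_norm_eq_one hv, mul_one']
  norm_map' x := by
    change ‖u * x * star v‖ = ‖x‖
    rw [RealCompositionAlgebra.norm_mul', RealCompositionAlgebra.norm_mul', norm_star', hu, hv,
      one_mul, mul_one]

/-- The isometry `A ↦ U A U*` for a diagonal matrix `U` with entries of norm one. -/
def diagonalConj (hassoc : ∀ x y z : F, x * y * z = x * (y * z)) (u : Fin (n + 1) → F)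
    (hu : ∀ i, ‖u i‖ = 1) : MatrixSpace F n ≃ₗᵢ[ℝ] MatrixSpace F n :=
  LinearIsometryEquiv.piLpCongrRight 2 fun p => twoSidedMul hassoc (hu p.1) (hu p.2)

lemma diagonalConj_apply (hassoc : ∀ x y z : F, x * y * z = x * (y * z)) (u : Fin (n + 1) → F)
    (hu : ∀ i, ‖u i‖ = 1) (A : MatrixSpace F n) (i j : Fin (n + 1)) :
    diagonalConj hassoc u hu A (i, j) = u i * A (i, j) * star (u j) := rfl

lemma diagonalConj_symm_apply (hassoc : ∀ x y z : F, x * y * z = x * (y * z)) (u : Fin (n + 1) → F)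
    (hu : ∀ i, ‖u i‖ = 1) (A : MatrixSpace F n) (i j : Fin (n + 1)) :
    (diagonalConj hassoc u hu).symm A (i, j) = star (u i) * A (i, j) * u j := rfl

lemma diagonalConj_maps (hassoc : ∀ x y z : F, x * y * z = x * (y * z)) (u : Fin (n + 1) → F)
    (hu : ∀ i, ‖u i‖ = 1) {A : MatrixSpace F n} (hA : A ∈ projectiveSpace F n) :
    diagonalConj hassoc u hu A ∈ projectiveSpace F n := by
  obtain ⟨h1, h2, h3⟩ := mem_projectiveSpace.1 hA
  refine mem_projectiveSpace.2 ⟨fun i j => ?_, fun i j => ?_, ?_⟩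
  · simp_rw [diagonalConj_apply, RealCompositionAlgebra.star_mul', star_star', h1, hassoc]
  · have e : ∀ k, diagonalConj hassoc u hu A (i, k) * diagonalConj hassoc u hu A (k, j) =
        u i * (A (i, k) * A (k, j)) * star (u j) := fun k => by
      simp_rw [diagonalConj_apply, hassoc]
      rw [← hassoc (star (u k)), star_mul_self_of_norm_eq_one (hu k), one_mul']
    simp_rw [e, ← sum_mul', ← mul_sum', h2]
    rfl
  · refine Eq.trans (Finset.sum_congr rfl fun i _ => ?_) h3
    rw [diagonalConj_apply, projectiveSpace_diag' hA, mul_smul', mul_one',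
      RealCompositionAlgebra.smul_mul', mul_star_self_of_norm_eq_one (hu i)]

lemma diagonalConj_mem (hassoc : ∀ x y z : F, x * y * z = x * (y * z)) (u : Fin (n + 1) → F)
    (hu : ∀ i, ‖u i‖ = 1) : diagonalConj hassoc u hu ∈ symmetryGroup (projectiveSpace F n) := by
  refine mem_symmetryGroup_of_maps (fun _ hx => diagonalConj_maps hassoc u hu hx) fun x hx => ?_
  convert diagonalConj_maps hassoc (fun i => star (u i)) (fun i => by rw [norm_star', hu]) hx
    using 1
  ext ⟨i, j⟩
  rw [diagonalConj_symm_apply, diagonalConj_apply, star_star']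

/-- Since A_ij = A_kk⁻¹ A_ik A_kj, unit phases u_i with u_i A_ik = |A_ik| make every entry of UAU*
real. Conjugation by a diagonal U fixes the base point. -/
theorem isProjectiveGeometry_of_assoc (hassoc : ∀ x y z : F, x * y * z = x * (y * z)) :
    IsProjectiveGeometry F n where
  mul_mul A hA i k j := projectiveSpace_mul_mul_of_assoc hassoc hA i k j
  vector_mul w _ i k j := by
    rw [hassoc, ← hassoc (star _), star_mul_self', RealCompositionAlgebra.smul_mul', mul_smul',
      one_mul']
  exists_real A hA := by
    obtain ⟨k, -, hk⟩ := Finset.exists_ne_zero_of_sum_ne_zero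
      ((sum_norm_projectiveSpace_diag hA).trans_ne one_ne_zero)
    choose u hu hux using fun i => exists_phase (A (i, k))
    refine ⟨diagonalConj hassoc u hu, diagonalConj_mem hassoc u hu, ?_,
      fun i j => ‖A (k, k)‖⁻¹ * (‖A (i, k)‖ * ‖A (j, k)‖), fun i j => ?_⟩
    · ext ⟨i, j⟩
      rw [diagonalConj_apply, realRankOne_apply, mul_smul', mul_one',
        RealCompositionAlgebra.smul_mul']
      by_cases hi : i = 0
      · by_cases hj : j = 0
        · rw [hi, hj, mul_star_self_of_norm_eq_one (hu 0)]
        · simp [hj]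
      · simp [hi]
    · have h2 : A (k, j) * star (u j) = ‖A (j, k)‖ • (1 : F) := by
        rw [← (mem_projectiveSpace.1 hA).1 k j, ← RealCompositionAlgebra.star_mul', hux, star_smul',
          star_one']
      have h3 : A (i, j) = ‖A (k, k)‖⁻¹ • (A (i, k) * A (k, j)) := by
        rw [projectiveSpace_mul_mul_of_assoc hassoc hA, smul_smul, inv_mul_cancel₀ hk, one_smul]
      rw [diagonalConj_apply, h3, mul_smul', RealCompositionAlgebra.smul_mul', ← hassoc, hux,
        hassoc, h2, RealCompositionAlgebra.smul_mul', one_mul', smul_smul, smul_smul, mul_assoc]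

instance : RealCompositionAlgebra ℝ where
  add_mul' := add_mul
  mul_add' := mul_add
  smul_mul' := smul_mul_assoc
  mul_smul' r x y := mul_smul_comm r x y
  one_mul' := one_mul
  mul_one' := mul_one
  norm_mul' := norm_mul
  norm_one' := norm_one
  star_mul' x y := by simp [mul_comm]
  star_star' x := by simp
  star_add' x y := by simp
  star_smul' r x := by simp
  norm_star' x := by simp
  mul_star_self' x := by simp [sq]

instance : RealCompositionAlgebra ℂ where
  add_mul' := add_mul
  mul_add' := mul_add
  smul_mul' := smul_mul_assoc
  mul_smul' r x y := mul_smul_comm r x y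
  one_mul' := one_mul
  mul_one' := mul_one
  norm_mul' := norm_mul
  norm_one' := norm_one
  star_mul' x y := by simp [mul_comm]
  star_star' x := by simp
  star_add' x y := by simp
  star_smul' r x := by simp
  norm_star' x := by simp
  mul_star_self' x := by
    rw [Complex.star_def, Complex.mul_conj, Complex.normSq_eq_norm_sq]
    simp

instance : RealCompositionAlgebra ℍ[ℝ] where
  add_mul' := add_mul
  mul_add' := mul_add
  smul_mul' := smul_mul_assoc
  mul_smul' r x y := mul_smul_comm r x y
  one_mul' := one_mul
  mul_one' := mul_one
  norm_mul' := norm_mul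
  norm_one' := norm_one
  star_mul' x y := by simp
  star_star' x := by simp
  star_add' x y := by simp
  star_smul' r x := by simp
  norm_star' x := by simp
  mul_star_self' x := by
    rw [Quaternion.self_mul_star, Quaternion.normSq_eq_norm_mul_self, ← sq, Algebra.smul_def,
      mul_one]
    rfl

theorem invariancePrinciple_realProjective (n : ℕ) (hn : 2 ≤ n) :
    (TwoPointSpace.realProjective n hn).InvariancePrinciple :=
  @IsProjectiveGeometry.stolarsky ℝ _ _ _ _ _ n _ (isProjectiveGeometry_of_assoc mul_assoc) _
    (by omega) (TwoPointSpace.instMeasurableSpaceAmbient (TwoPointSpace.realProjective n hn))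
    (TwoPointSpace.instBorelSpaceAmbient (TwoPointSpace.realProjective n hn)) n (by simp)
    (TwoPointSpace.realProjective n hn).theta (fun _ _ => rfl)
    (TwoPointSpace.realProjective n hn).mu rfl
    (TwoPointSpace.realProjective n hn).tau (fun _ _ => rfl)

theorem invariancePrinciple_complexProjective (n : ℕ) (hn : 2 ≤ n) :
    (TwoPointSpace.complexProjective n hn).InvariancePrinciple :=
  @IsProjectiveGeometry.stolarsky ℂ _ _ _ _ _ n _ (isProjectiveGeometry_of_assoc mul_assoc) _
    (by omega) (TwoPointSpace.instMeasurableSpaceAmbient (TwoPointSpace.complexProjective n hn))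
    (TwoPointSpace.instBorelSpaceAmbient (TwoPointSpace.complexProjective n hn)) (2 * n)
    (by simp [mul_comm])
    (TwoPointSpace.complexProjective n hn).theta (fun _ _ => rfl)
    (TwoPointSpace.complexProjective n hn).mu rfl
    (TwoPointSpace.complexProjective n hn).tau (fun _ _ => rfl)

theorem invariancePrinciple_quaternionicProjective (n : ℕ) (hn : 2 ≤ n) :
    (TwoPointSpace.quaternionicProjective n hn).InvariancePrinciple :=
  @IsProjectiveGeometry.stolarsky ℍ[ℝ] _ _ _ _ _ n _ (isProjectiveGeometry_of_assoc mul_assoc) _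
    (by omega) (TwoPointSpace.instMeasurableSpaceAmbient (TwoPointSpace.quaternionicProjective n hn))
    (TwoPointSpace.instBorelSpaceAmbient (TwoPointSpace.quaternionicProjective n hn)) (4 * n)
    (by rw [Quaternion.finrank_eq_four, mul_comm])
    (TwoPointSpace.quaternionicProjective n hn).theta (fun _ _ => rfl)
    (TwoPointSpace.quaternionicProjective n hn).mu rfl
    (TwoPointSpace.quaternionicProjective n hn).tau (fun _ _ => rfl)

end Associative

/-! ### Octonion identities. -/

section OctonionAlgebra

namespace Octonion

@[simp] lemma left_mk (a b : ℍ[ℝ]) : (mk a b).left = a := rfl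
@[simp] lemma right_mk (a b : ℍ[ℝ]) : (mk a b).right = b := rfl
@[simp] lemma left_add (x y : Octonion) : (x + y).left = x.left + y.left := rfl
@[simp] lemma right_add (x y : Octonion) : (x + y).right = x.right + y.right := rfl
@[simp] lemma left_smul (r : ℝ) (x : Octonion) : (r • x).left = r • x.left := rfl
@[simp] lemma right_smul (r : ℝ) (x : Octonion) : (r • x).right = r • x.right := rfl
@[simp] lemma left_one : (1 : Octonion).left = 1 := rfl
@[simp] lemma right_one : (1 : Octonion).right = 0 := rfl
@[simp] lemma left_star (x : Octonion) : (star x).left = star x.left := rfl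
@[simp] lemma right_star (x : Octonion) : (star x).right = -x.right := rfl
@[simp] lemma left_mul (x y : Octonion) :
    (x * y).left = x.left * y.left - star y.right * x.right := rfl
@[simp] lemma right_mul (x y : Octonion) :
    (x * y).right = y.right * x.left + x.right * star y.left := rfl

lemma ext' {x y : Octonion} (h1 : x.left = y.left) (h2 : x.right = y.right) : x = y :=
  (WithLp.ofLp_injective 2) (Prod.ext h1 h2)

lemma norm_sq_eq (x : Octonion) : ‖x‖ ^ 2 = ‖x.left‖ ^ 2 + ‖x.right‖ ^ 2 :=
  WithLp.prod_norm_sq_eq_of_L2 x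

lemma quaternion_norm_sq (a : ℍ[ℝ]) :
    ‖a‖ ^ 2 = a.re ^ 2 + a.imI ^ 2 + a.imJ ^ 2 + a.imK ^ 2 := by
  rw [sq, ← Quaternion.normSq_eq_norm_mul_self, Quaternion.normSq_def']

/-- The Moufang identities replace associativity in the construction of symmetries; being
polynomial, they can be checked on real coordinates. -/
lemma middle_moufang (u x y : Octonion) : (u * x) * (y * u) = (u * (x * y)) * u := by
  apply ext' <;> ext <;> simp only [left_mul, right_mul, Quaternion.re_sub,
    Quaternion.imI_sub, Quaternion.imJ_sub, Quaternion.imK_sub,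
    Quaternion.re_add,
    Quaternion.imI_add, Quaternion.imJ_add, Quaternion.imK_add,
    Quaternion.re_mul, Quaternion.imI_mul, Quaternion.imJ_mul, Quaternion.imK_mul,
    Quaternion.re_star, Quaternion.imI_star, Quaternion.imJ_star, Quaternion.imK_star] <;> ring

lemma left_moufang (u x y : Octonion) : ((u * x) * u) * y = u * (x * (u * y)) := by
  apply ext' <;> ext <;> simp only [left_mul, right_mul, Quaternion.re_sub,
    Quaternion.imI_sub, Quaternion.imJ_sub, Quaternion.imK_sub,
    Quaternion.re_add,
    Quaternion.imI_add, Quaternion.imJ_add, Quaternion.imK_add,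
    Quaternion.re_mul, Quaternion.imI_mul, Quaternion.imJ_mul, Quaternion.imK_mul,
    Quaternion.re_star, Quaternion.imI_star, Quaternion.imJ_star, Quaternion.imK_star] <;> ring

lemma flexible (u x : Octonion) : (u * x) * u = u * (x * u) := by
  apply ext' <;> ext <;> simp <;> ring

/-- This form of alternativity makes left multiplication by a unit octonion invertible, with the
conjugate as inverse. -/
lemma star_mul_mul (x y : Octonion) : star x * (x * y) = ‖x‖ ^ 2 • y := by
  apply ext' <;> ext <;> simp [norm_sq_eq, quaternion_norm_sq] <;> ring

lemma norm_mul_sq (x y : Octonion) : ‖x * y‖ ^ 2 = ‖x‖ ^ 2 * ‖y‖ ^ 2 := by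
  simp only [norm_sq_eq, quaternion_norm_sq]
  simp
  ring

instance : FiniteDimensional ℝ Octonion :=
  inferInstanceAs (FiniteDimensional ℝ (WithLp 2 (ℍ[ℝ] × ℍ[ℝ])))

lemma finrank_eq_eight : Module.finrank ℝ Octonion = 8 := by
  have := (WithLp.linearEquiv 2 ℝ (ℍ[ℝ] × ℍ[ℝ])).finrank_eq
  rw [Module.finrank_prod, Quaternion.finrank_eq_four] at this
  exact this

end Octonion

instance : RealCompositionAlgebra Octonion where
  add_mul' x y z := by apply Octonion.ext' <;> simp [add_mul, mul_add] <;> abel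
  mul_add' x y z := by apply Octonion.ext' <;> simp [add_mul, mul_add] <;> abel
  smul_mul' r x y := by apply Octonion.ext' <;> simp [smul_sub]
  mul_smul' r x y := by apply Octonion.ext' <;> simp [smul_sub]
  one_mul' x := by apply Octonion.ext' <;> simp
  mul_one' x := by apply Octonion.ext' <;> simp
  norm_mul' x y := by
    rw [← sq_eq_sq₀ (norm_nonneg _) (by positivity), Octonion.norm_mul_sq, mul_pow]
  norm_one' := by
    rw [← sq_eq_sq₀ (norm_nonneg _) (by positivity), Octonion.norm_sq_eq]
    simp
  star_mul' x y := by apply Octonion.ext' <;> simp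
  star_star' x := by apply Octonion.ext' <;> simp
  star_add' x y := by apply Octonion.ext' <;> simp; abel
  star_smul' r x := by apply Octonion.ext' <;> simp
  norm_star' x := by
    rw [← sq_eq_sq₀ (norm_nonneg _) (by positivity), Octonion.norm_sq_eq, Octonion.norm_sq_eq]
    simp
  mul_star_self' x := by
    apply Octonion.ext' <;> ext <;>
      simp [Octonion.norm_sq_eq, Octonion.quaternion_norm_sq] <;> ring

end OctonionAlgebra

/-! ### Symmetries of the octonionic projective plane. -/

section OctonionicPlane

open RealCompositionAlgebra

namespace Octonion

lemma mul_mul_star (x y : Octonion) : y * x * star x = ‖x‖ ^ 2 • y := by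
  have := congrArg star (star_mul_mul (star x) (star y))
  simpa only [RealCompositionAlgebra.star_mul', star_star', star_smul', norm_star'] using this

lemma mul_star_mul (x y : Octonion) : y * star x * x = ‖x‖ ^ 2 • y := by
  have := mul_mul_star (star x) y
  rwa [star_star', norm_star'] at this

lemma right_moufang (u x y : Octonion) : y * ((u * x) * u) = ((y * u) * x) * u := by
  have := congrArg star (left_moufang (star u) (star x) (star y))
  simp only [RealCompositionAlgebra.star_mul', star_star'] at this
  rw [flexible]
  exact this

variable {u : Octonion}

lemma star_mul_cancel (hu : ‖u‖ = 1) (x : Octonion) : star u * (u * x) = x := by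
  rw [star_mul_mul, hu, one_pow, one_smul]

lemma mul_star_mul_cancel (hu : ‖u‖ = 1) (x : Octonion) : u * (star u * x) = x := by
  have := star_mul_cancel (u := star u) (by rwa [norm_star']) x
  rwa [star_star'] at this

lemma mul_cancel_star (hu : ‖u‖ = 1) (x : Octonion) : x * u * star u = x := by
  rw [mul_mul_star, hu, one_pow, one_smul]

lemma mul_star_cancel (hu : ‖u‖ = 1) (x : Octonion) : x * star u * u = x := by
  rw [mul_star_mul, hu, one_pow, one_smul]

/-- Left multiplication by an octonion of norm one. -/
def leftMul (hu : ‖u‖ = 1) : Octonion ≃ₗᵢ[ℝ] Octonion where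
  toFun x := u * x
  invFun x := star u * x
  map_add' := mul_add' u
  map_smul' r x := mul_smul' r u x
  left_inv := star_mul_cancel hu
  right_inv := mul_star_mul_cancel hu
  norm_map' x := by
    change ‖u * x‖ = ‖x‖
    rw [RealCompositionAlgebra.norm_mul', hu, one_mul]

/-- Right multiplication by an octonion of norm one. -/
def rightMul (hu : ‖u‖ = 1) : Octonion ≃ₗᵢ[ℝ] Octonion where
  toFun x := x * u
  invFun x := x * star u
  map_add' x y := add_mul' x y u
  map_smul' r x := RealCompositionAlgebra.smul_mul' r x u
  left_inv := mul_cancel_star hu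
  right_inv := mul_star_cancel hu
  norm_map' x := by
    change ‖x * u‖ = ‖x‖
    rw [RealCompositionAlgebra.norm_mul', hu, mul_one]

lemma norm_star_eq_one (hu : ‖u‖ = 1) : ‖star u‖ = 1 := by rwa [norm_star']

/-- The action of an octonion of norm one on the entries of a `3 × 3` matrix: the components of
a triality automorphism. -/
def triality (hu : ‖u‖ = 1) (p : Fin 3 × Fin 3) : Octonion ≃ₗᵢ[ℝ] Octonion :=
  (![![.refl ℝ _, (leftMul (norm_star_eq_one hu)).trans (rightMul (norm_star_eq_one hu)),
      leftMul (norm_star_eq_one hu)],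
    ![(leftMul hu).trans (rightMul hu), .refl ℝ _, leftMul hu],
    ![rightMul hu, rightMul (norm_star_eq_one hu), .refl ℝ _]] :
    Fin 3 → Fin 3 → (Octonion ≃ₗᵢ[ℝ] Octonion)) p.1 p.2

section TrialityEntries

variable (hu : ‖u‖ = 1) (x : Octonion)

lemma triality_diag (i : Fin 3) : triality hu (i, i) x = x := by fin_cases i <;> rfl
lemma triality_zero_one : triality hu (0, 1) x = star u * x * star u := rfl
lemma triality_zero_two : triality hu (0, 2) x = star u * x := rfl
lemma triality_one_zero : triality hu (1, 0) x = u * x * u := rfl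
lemma triality_one_two : triality hu (1, 2) x = u * x := rfl
lemma triality_two_zero : triality hu (2, 0) x = x * u := rfl
lemma triality_two_one : triality hu (2, 1) x = x * star u := rfl

end TrialityEntries

lemma star_triality (hu : ‖u‖ = 1) (i j : Fin 3) (x : Octonion) :
    star (triality hu (j, i) x) = triality hu (i, j) (star x) := by
  fin_cases i <;> fin_cases j <;>
    simp [triality_diag, triality_zero_one, triality_zero_two, triality_one_zero,
      triality_one_two, triality_two_zero, triality_two_one, RealCompositionAlgebra.star_mul',
      star_star', flexible]

/-- Distinct indices leave six products: two are the middle Moufang identity, the others a left or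
right Moufang identity followed by cancelling a unit. Repeated indices are left out since there real
diagonal entries or norms suffice. -/
lemma triality_mul (hu : ‖u‖ = 1) {i k j : Fin 3} (hik : i ≠ k) (hkj : k ≠ j) (hij : i ≠ j)
    (x y : Octonion) :
    triality hu (i, k) x * triality hu (k, j) y = triality hu (i, j) (x * y) := by
  have h1 : star u * x * star u * (u * y) = star u * (x * y) := by
    rw [left_moufang, star_mul_cancel hu]
  have h2 : u * x * u * (star u * y) = u * (x * y) := by
    rw [left_moufang, mul_star_mul_cancel hu]
  have h3 : x * u * (star u * y * star u) = x * y * star u := by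
    rw [right_moufang, mul_cancel_star hu]
  have h4 : x * star u * (u * y * u) = x * y * u := by
    rw [right_moufang, mul_star_cancel hu]
  fin_cases i <;> fin_cases k <;> fin_cases j <;>
    simp [triality_zero_one, triality_zero_two, triality_one_zero,
      triality_one_two, triality_two_zero, triality_two_one, middle_moufang, h1, h2, h3, h4]
      at hik hkj hij ⊢

lemma triality_symm (hu : ‖u‖ = 1) (p : Fin 3 × Fin 3) (x : Octonion) :
    (triality hu p).symm x = triality (norm_star_eq_one hu) p x := by
  rw [LinearIsometryEquiv.symm_apply_eq]
  obtain ⟨i, j⟩ := p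
  fin_cases i <;> fin_cases j <;>
    simp [triality_diag, triality_zero_one, triality_zero_two, triality_one_zero,
      triality_one_two, triality_two_zero, triality_two_one, star_star', flexible,
      star_mul_cancel hu, mul_star_mul_cancel hu, mul_cancel_star hu, mul_star_cancel hu]

/-- The isometry of the space of `3 × 3` octonionic matrices given by `triality`. -/
def trialityEquiv (hu : ‖u‖ = 1) : MatrixSpace Octonion 2 ≃ₗᵢ[ℝ] MatrixSpace Octonion 2 :=
  LinearIsometryEquiv.piLpCongrRight 2 (triality hu)

lemma trialityEquiv_apply (hu : ‖u‖ = 1) (A : MatrixSpace Octonion 2) (p : Fin 3 × Fin 3) :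
    trialityEquiv hu A p = triality hu p (A p) := rfl

/-- Diagonal entries and the norms of all entries are unchanged, which settles the diagonal of A² =
A. Off the diagonal, a product either has a real diagonal factor or involves three distinct indices.
-/
lemma trialityEquiv_maps (hu : ‖u‖ = 1) {A : MatrixSpace Octonion 2}
    (hA : A ∈ projectiveSpace Octonion 2) : trialityEquiv hu A ∈ projectiveSpace Octonion 2 := by
  obtain ⟨h1, h2, h3⟩ := mem_projectiveSpace.1 hA
  have hs : ∀ i j, star (trialityEquiv hu A (j, i)) = trialityEquiv hu A (i, j) := fun i j => by
    rw [trialityEquiv_apply, trialityEquiv_apply, star_triality, h1]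
  have hd : ∀ i, trialityEquiv hu A (i, i) = A (i, i) := fun i => by
    rw [trialityEquiv_apply, triality_diag]
  refine mem_projectiveSpace.2 ⟨hs, fun i j => ?_, ?_⟩
  · by_cases hij : i = j
    · subst hij
      rw [hd, projectiveSpace_diag hA, Finset.sum_smul]
      refine Finset.sum_congr rfl fun k _ => ?_
      rw [← hs k i, mul_star_self', trialityEquiv_apply, LinearIsometryEquiv.norm_map]
    · rw [trialityEquiv_apply hu A (i, j), ← h2 i j, map_sum]
      refine Finset.sum_congr rfl fun k _ => ?_
      by_cases hik : i = k
      · subst hik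
        rw [hd, projectiveSpace_diag' hA, RealCompositionAlgebra.smul_mul',
          RealCompositionAlgebra.smul_mul', one_mul', one_mul', map_smul, trialityEquiv_apply]
      · by_cases hkj : k = j
        · subst hkj
          rw [hd, projectiveSpace_diag' hA, mul_smul', mul_smul', mul_one', mul_one', map_smul,
            trialityEquiv_apply]
        · exact triality_mul hu hik hkj hij _ _
  · simp_rw [hd, h3]

lemma trialityEquiv_mem (hu : ‖u‖ = 1) :
    trialityEquiv hu ∈ symmetryGroup (projectiveSpace Octonion 2) := by
  refine mem_symmetryGroup_of_maps (fun _ hx => trialityEquiv_maps hu hx) fun x hx => ?_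
  convert trialityEquiv_maps (norm_star_eq_one hu) hx using 1
  ext p
  exact triality_symm hu p (x p)

lemma trialityEquiv_base (hu : ‖u‖ = 1) :
    trialityEquiv hu (realRankOne Octonion (Pi.single 0 1)) =
      realRankOne Octonion (Pi.single 0 1) := by
  ext ⟨i, j⟩
  rw [trialityEquiv_apply, realRankOne_apply, map_smul]
  by_cases hi : i = 0
  · by_cases hj : j = 0
    · rw [hi, hj, triality_diag]
    · simp [hj]
  · simp [hi]

/-- Size 3 makes up for the lack of associativity. For distinct i, k, j the (i, j) entry of A² = A
reads (A_ii + A_jj)A_ij + A_ik A_kj = A_ij, and trace one identifies 1 - A_ii - A_jj with A_kk. -/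
lemma projectiveSpace_mul_mul {A : MatrixSpace Octonion 2} (hA : A ∈ projectiveSpace Octonion 2)
    (i k j : Fin 3) : A (i, k) * A (k, j) = ‖A (k, k)‖ • A (i, j) := by
  obtain ⟨h1, h2, -⟩ := mem_projectiveSpace.1 hA
  have hdist : ∀ i k j : Fin 3, i ≠ k → k ≠ j → i ≠ j → ∀ {G : Type} [AddCommMonoid G]
      (f : Fin 3 → G), ∑ m, f m = f i + f j + f k := by
    intro i k j hik hkj hij G _ f
    rw [Fin.sum_univ_three]
    fin_cases i <;> fin_cases k <;> fin_cases j <;> simp at hik hkj hij ⊢ <;> abel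
  by_cases hik : i = k
  · subst hik
    nth_rewrite 1 [projectiveSpace_diag' hA]
    rw [RealCompositionAlgebra.smul_mul', one_mul']
  by_cases hkj : k = j
  · subst hkj
    nth_rewrite 1 [projectiveSpace_diag' hA]
    rw [mul_smul', mul_one']
  have htr := sum_norm_projectiveSpace_diag hA
  by_cases hij : i = j
  · subst hij
    rw [← h1 k i, mul_star_self', projectiveSpace_diag' hA i, smul_smul]
    congr 1
    obtain ⟨m, hmi, hmk⟩ : ∃ m : Fin 3, m ≠ i ∧ m ≠ k := by
      revert i k; decide
    rw [hdist i m k hmi.symm hmk hik] at htr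
    have ei := norm_projectiveSpace_diag hA i
    have ek := norm_projectiveSpace_diag hA k
    have em := norm_projectiveSpace_diag hA m
    rw [hdist i m k hmi.symm hmk hik] at ei ek em
    rw [projectiveSpace_swap_norm hA k i] at ek
    rw [projectiveSpace_swap_norm hA m i, projectiveSpace_swap_norm hA m k] at em
    -- The products of diagonal entries satisfy the same invertible linear system as the squared
    -- norms of the off-diagonal entries, hence |A_ik|² = A_ii A_kk.
    have e1 : ‖A (i, i)‖ * ‖A (m, m)‖ + ‖A (i, i)‖ * ‖A (k, k)‖ =
        ‖A (i, i)‖ - ‖A (i, i)‖ ^ 2 := by linear_combination ‖A (i, i)‖ * htr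
    have e2 : ‖A (k, k)‖ * ‖A (m, m)‖ + ‖A (i, i)‖ * ‖A (k, k)‖ =
        ‖A (k, k)‖ - ‖A (k, k)‖ ^ 2 := by linear_combination ‖A (k, k)‖ * htr
    have e3 : ‖A (i, i)‖ * ‖A (m, m)‖ + ‖A (k, k)‖ * ‖A (m, m)‖ =
        ‖A (m, m)‖ - ‖A (m, m)‖ ^ 2 := by linear_combination ‖A (m, m)‖ * htr
    linarith
  · have h := h2 i j
    have hi : A (i, i) * A (i, j) = ‖A (i, i)‖ • A (i, j) := by
      nth_rewrite 1 [projectiveSpace_diag' hA i]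
      rw [RealCompositionAlgebra.smul_mul', one_mul']
    have hj : A (i, j) * A (j, j) = ‖A (j, j)‖ • A (i, j) := by
      nth_rewrite 1 [projectiveSpace_diag' hA j]
      rw [mul_smul', mul_one']
    rw [hdist i k j hik hkj hij, hi, hj] at h
    rw [hdist i k j hik hkj hij] at htr
    rw [← sub_eq_iff_eq_add'.2 h.symm, show ‖A (k, k)‖ = 1 - ‖A (i, i)‖ - ‖A (j, j)‖ by linarith]
    module

/-- Three distinct indices in a set of three include 0, where w is real; the claim then reduces to
alternativity. With a repeated index, norms suffice. -/
lemma vector_mul_mul (w : Fin 3 → Octonion) (hw : ∃ r : ℝ, w 0 = r • (1 : Octonion))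
    (i k j : Fin 3) :
    (w i * star (w k)) * (w k * star (w j)) = ‖w k‖ ^ 2 • (w i * star (w j)) := by
  by_cases hik : i = k
  · rw [hik, mul_star_self', RealCompositionAlgebra.smul_mul', one_mul']
  by_cases hkj : k = j
  · rw [hkj, mul_star_self', mul_smul', mul_one']
  by_cases hij : i = j
  · rw [hij, show w k * star (w j) = star (w j * star (w k)) by
      rw [RealCompositionAlgebra.star_mul', star_star'], mul_star_self', mul_star_self', smul_smul,
      RealCompositionAlgebra.norm_mul', norm_star']
    congr 1
    ring
  obtain ⟨r, hr⟩ := hw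
  have h0 : i = 0 ∨ k = 0 ∨ j = 0 := by
    revert i k j; decide
  rcases h0 with h | h | h
  · rw [h, hr, RealCompositionAlgebra.smul_mul', RealCompositionAlgebra.smul_mul',
      RealCompositionAlgebra.smul_mul', one_mul', one_mul', star_mul_mul, smul_comm]
  · rw [h, hr, norm_smul_one, sq_abs, star_smul', star_one', mul_smul', mul_one',
      RealCompositionAlgebra.smul_mul', RealCompositionAlgebra.smul_mul', mul_smul', one_mul',
      smul_smul, sq]
  · rw [h, hr, star_smul', star_one', mul_smul', mul_smul', mul_smul', mul_one', mul_one',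
      mul_star_mul, smul_comm]

/-- Rotation by `(c, s)` of the last two coordinates. -/
def blockRotation (c s : ℝ) : Matrix (Fin 3) (Fin 3) ℝ := !![1, 0, 0; 0, c, s; 0, -s, c]

lemma blockRotation_orthogonal {c s : ℝ} (h : c ^ 2 + s ^ 2 = 1) :
    (blockRotation c s).transpose * blockRotation c s = 1 := by
  ext i j
  fin_cases i <;> fin_cases j <;>
    simp [blockRotation, Matrix.mul_apply, Fin.sum_univ_three] <;> linarith

lemma blockRotation_base {c s : ℝ} (h : c ^ 2 + s ^ 2 = 1) :
    realConjEquiv Octonion (blockRotation c s) (blockRotation_orthogonal h)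
      (realRankOne Octonion (Pi.single 0 1)) = realRankOne Octonion (Pi.single 0 1) := by
  refine (realConj_realRankOne _ _).trans ?_
  congr 1
  ext i
  fin_cases i <;> simp [blockRotation, Matrix.mulVec, dotProduct, Fin.sum_univ_three]

/-- A point can be made real by a symmetry that fixes the base point. -/
def RealUpToSymmetry (A : MatrixSpace Octonion 2) : Prop :=
  ∃ g ∈ symmetryGroup (projectiveSpace Octonion 2),
    g (realRankOne Octonion (Pi.single 0 1)) = realRankOne Octonion (Pi.single 0 1) ∧
    ∃ r : Fin 3 → Fin 3 → ℝ, ∀ i j, g A (i, j) = r i j • (1 : Octonion)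

lemma RealUpToSymmetry.of_map {A : MatrixSpace Octonion 2}
    {g : MatrixSpace Octonion 2 ≃ₗᵢ[ℝ] MatrixSpace Octonion 2}
    (hg : g ∈ symmetryGroup (projectiveSpace Octonion 2))
    (hg0 : g (realRankOne Octonion (Pi.single 0 1)) = realRankOne Octonion (Pi.single 0 1))
    (h : RealUpToSymmetry (g A)) : RealUpToSymmetry A := by
  obtain ⟨g', hg', hg0', r, hr⟩ := h
  refine ⟨g' * g, mul_mem hg' hg, ?_, r, hr⟩
  change g' (g _) = _
  rw [hg0, hg0']

/-- Only the entries (2, 0) and (0, 2) can fail to be real. The triality map multiplies the former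
on the right by a unit octonion, which is chosen to make it real. -/
lemma realUpToSymmetry_of_zero_zero {A : MatrixSpace Octonion 2}
    (hA : A ∈ projectiveSpace Octonion 2) (h12 : A (1, 2) = 0) (h10 : A (1, 0) = 0) :
    RealUpToSymmetry A := by
  have hs := (mem_projectiveSpace.1 hA).1
  have h21 : A (2, 1) = 0 := by rw [← hs 2 1, h12, star_zero']
  have h01 : A (0, 1) = 0 := by rw [← hs 0 1, h10, star_zero']
  obtain ⟨v, hv, hvA⟩ := exists_phase (star (A (2, 0)))
  have hvA' : A (2, 0) * star v = ‖A (2, 0)‖ • (1 : Octonion) := by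
    have := congrArg star hvA
    rwa [RealCompositionAlgebra.star_mul', star_star', star_smul', star_one', norm_star'] at this
  have hu := norm_star_eq_one hv
  have hreal : ∀ i j, ∃ r : ℝ, trialityEquiv hu A (i, j) = r • (1 : Octonion) := by
    have hd : ∀ i, ∃ r : ℝ, trialityEquiv hu A (i, i) = r • (1 : Octonion) := fun i =>
      ⟨‖A (i, i)‖, by rw [trialityEquiv_apply, triality_diag, ← projectiveSpace_diag' hA]⟩
    have hz : ∀ p, A p = 0 → ∃ r : ℝ, trialityEquiv hu A p = r • (1 : Octonion) := fun p hp =>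
      ⟨0, by rw [trialityEquiv_apply, hp, map_zero, zero_smul]⟩
    have h20 : trialityEquiv hu A (2, 0) = ‖A (2, 0)‖ • (1 : Octonion) := by
      rw [trialityEquiv_apply, triality_two_zero, hvA']
    intro i j
    fin_cases i <;> fin_cases j
    · exact hd 0
    · exact hz _ h01
    · refine ⟨‖A (2, 0)‖, ?_⟩
      have := (mem_projectiveSpace.1 (trialityEquiv_maps hu hA)).1 0 2
      rw [h20, star_smul', star_one'] at this
      exact this.symm
    · exact hz _ h10
    · exact hd 1
    · exact hz _ h12
    · exact ⟨_, h20⟩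
    · exact hz _ h21
    · exact hd 2
  choose r hr using hreal
  exact ⟨_, trialityEquiv_mem hu, trialityEquiv_base hu, r, hr⟩

/-- Here A₁₀A₀₂ = A₀₀A₁₂ = 0, and a multiplicative norm excludes zero divisors. If it is A₀₂ that
vanishes, a quarter turn exchanges the last two coordinates up to sign. -/
lemma realUpToSymmetry_of_zero {A : MatrixSpace Octonion 2}
    (hA : A ∈ projectiveSpace Octonion 2) (h12 : A (1, 2) = 0) : RealUpToSymmetry A := by
  have h := projectiveSpace_mul_mul hA 1 0 2
  rw [h12, smul_zero] at h
  have h' : ‖A (1, 0)‖ * ‖A (0, 2)‖ = 0 := by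
    rw [← RealCompositionAlgebra.norm_mul', h, norm_zero]
  rcases mul_eq_zero.1 h' with h0 | h0
  · exact realUpToSymmetry_of_zero_zero hA h12 (norm_eq_zero.1 h0)
  · have h20 : A (2, 0) = 0 := by
      rw [← (mem_projectiveSpace.1 hA).1 2 0, norm_eq_zero.1 h0, star_zero']
    have h21 : A (2, 1) = 0 := by rw [← (mem_projectiveSpace.1 hA).1 2 1, h12, star_zero']
    have hrot : (0 : ℝ) ^ 2 + 1 ^ 2 = 1 := by norm_num
    refine .of_map (realConjEquiv_mem (blockRotation_orthogonal hrot)) (blockRotation_base hrot)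
      (realUpToSymmetry_of_zero_zero ((realConjEquiv_mem (blockRotation_orthogonal hrot) _).2 hA)
        ?_ ?_)
    · change realConj Octonion (blockRotation 0 1) A (1, 2) = 0
      simp [realConj_apply, Fin.sum_univ_three, blockRotation, h21]
    · change realConj Octonion (blockRotation 0 1) A (1, 0) = 0
      simp [realConj_apply, Fin.sum_univ_three, blockRotation, h20]

lemma exists_rotation_orthogonal (a b : ℝ) : ∃ c s : ℝ, c ^ 2 + s ^ 2 = 1 ∧ c * b = s * a := by
  by_cases h : a ^ 2 + b ^ 2 = 0
  · have ha : a = 0 := by nlinarith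
    have hb : b = 0 := by nlinarith
    exact ⟨1, 0, by norm_num, by rw [ha, hb]; norm_num⟩
  · have hpos : 0 < a ^ 2 + b ^ 2 := lt_of_le_of_ne (by positivity) (Ne.symm h)
    have hs := Real.sq_sqrt hpos.le
    have hne : Real.sqrt (a ^ 2 + b ^ 2) ≠ 0 := (Real.sqrt_pos.2 hpos).ne'
    refine ⟨a / Real.sqrt (a ^ 2 + b ^ 2), b / Real.sqrt (a ^ 2 + b ^ 2), ?_, by ring⟩
    rw [div_pow, div_pow, ← add_div, hs, div_self h]

/-- Triality makes the (1, 2) entry a nonnegative real. The lower 2 × 2 block is then the real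
rank-one matrix of the vector (√B₁₁, √B₂₂), and rotating this vector onto an axis kills the
off-diagonal entry. -/
lemma realUpToSymmetry {A : MatrixSpace Octonion 2}
    (hA : A ∈ projectiveSpace Octonion 2) : RealUpToSymmetry A := by
  obtain ⟨u, hu, huA⟩ := exists_phase (A (1, 2))
  refine .of_map (trialityEquiv_mem hu) (trialityEquiv_base hu) ?_
  have hB := trialityEquiv_maps hu hA
  set B := trialityEquiv hu A
  have hB12 : B (1, 2) = ‖B (1, 2)‖ • (1 : Octonion) := by
    have : B (1, 2) = ‖A (1, 2)‖ • (1 : Octonion) := huA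
    rw [this, norm_smul_one, abs_norm]
  have hB21 : B (2, 1) = ‖B (1, 2)‖ • (1 : Octonion) := by
    rw [← (mem_projectiveSpace.1 hB).1 2 1, hB12, star_smul', star_one', norm_smul_one, abs_norm]
  have hprod : ‖B (1, 2)‖ ^ 2 = ‖B (1, 1)‖ * ‖B (2, 2)‖ := by
    have := congrArg norm (projectiveSpace_mul_mul hB 2 1 2)
    rw [RealCompositionAlgebra.norm_mul', norm_smul, norm_norm, projectiveSpace_swap_norm hB 2 1]
      at this
    rw [sq, this]
  obtain ⟨c, s, hcs, h⟩ := exists_rotation_orthogonal (Real.sqrt ‖B (1, 1)‖) (Real.sqrt ‖B (2, 2)‖)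
  refine .of_map (realConjEquiv_mem (blockRotation_orthogonal hcs)) (blockRotation_base hcs)
    (realUpToSymmetry_of_zero ((realConjEquiv_mem (blockRotation_orthogonal hcs) _).2 hB) ?_)
  change realConj Octonion (blockRotation c s) B (1, 2) = 0
  have hβ : ‖B (1, 2)‖ = Real.sqrt ‖B (1, 1)‖ * Real.sqrt ‖B (2, 2)‖ := by
    rw [← Real.sqrt_mul (norm_nonneg _), ← hprod, Real.sqrt_sq (norm_nonneg _)]
  have h1 := Real.mul_self_sqrt (norm_nonneg (B (1, 1)))
  have h2 := Real.mul_self_sqrt (norm_nonneg (B (2, 2)))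
  have e : realConj Octonion (blockRotation c s) B (1, 2) =
      (-(c * s) * ‖B (1, 1)‖ + c * c * ‖B (1, 2)‖ - s * s * ‖B (1, 2)‖ + s * c * ‖B (2, 2)‖) •
        (1 : Octonion) := by
    have e' : realConj Octonion (blockRotation c s) B (1, 2) = (-(c * s)) • B (1, 1) +
        (c * c) • B (1, 2) - (s * s) • B (2, 1) + (s * c) • B (2, 2) := by
      simp [realConj_apply, Fin.sum_univ_three, blockRotation]
      module
    rw [e']
    conv_lhs => rw [hB12, hB21, projectiveSpace_diag' hB 1, projectiveSpace_diag' hB 2]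
    module
  rw [e, hβ]
  generalize Real.sqrt ‖B (1, 1)‖ = p at *
  generalize Real.sqrt ‖B (2, 2)‖ = q at *
  rw [← h1, ← h2, show -(c * s) * (p * p) + c * c * (p * q) - s * s * (p * q) + s * c * (q * q) =
    (c * q - s * p) * (c * p + s * q) by ring, h]
  simp

theorem isProjectiveGeometry : IsProjectiveGeometry Octonion 2 where
  mul_mul _ hA i k j := projectiveSpace_mul_mul hA i k j
  vector_mul w hw i k j := vector_mul_mul w hw i k j
  exists_real _ hA := realUpToSymmetry hA

end Octonion

theorem invariancePrinciple_octonionicPlane : TwoPointSpace.octonionicPlane.InvariancePrinciple :=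
  @IsProjectiveGeometry.stolarsky Octonion _ _ _ _ _ 2 _ Octonion.isProjectiveGeometry _
    (by omega) (TwoPointSpace.instMeasurableSpaceAmbient TwoPointSpace.octonionicPlane)
    (TwoPointSpace.instBorelSpaceAmbient TwoPointSpace.octonionicPlane) 16
    (by rw [Octonion.finrank_eq_eight])
    TwoPointSpace.octonionicPlane.theta (fun _ _ => rfl)
    TwoPointSpace.octonionicPlane.mu rfl
    TwoPointSpace.octonionicPlane.tau (fun _ _ => rfl)

end OctonionicPlane

end

theorem corollary2p1 (Q : TwoPointSpace) :
    Q.gamma = diameter Q.tau / diameter (symmDiffMetric Q.theta Q.mu Real.sin) ∧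
    ∀ N : ℕ,
      (∀ D : Fin N → Q.Carrier,
        Q.gamma * quadraticDiscrepancy Q.theta Q.mu Real.sin D + distanceSum Q.tau D
          = averageDistance Q.mu Q.tau * (N : ℝ) ^ 2) ∧
      Q.gamma * extremalDiscrepancy Q.theta Q.mu Real.sin N + extremalDistanceSum Q.tau N
        = averageDistance Q.mu Q.tau * (N : ℝ) ^ 2 := by
  cases Q with
  | sphere d hd => exact invariancePrinciple_sphere d hd
  | realProjective n hn => exact invariancePrinciple_realProjective n hn
  | complexProjective n hn => exact invariancePrinciple_complexProjective n hn
  | quaternionicProjective n hn => exact invariancePrinciple_quaternionicProjective n hn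
  | octonionicPlane => exact invariancePrinciple_octonionicPlane
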